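/- Let $K$ be a number field and $n,N\ge 0$. For an effective cycle $C=\sum_Z a_Z Z$ of pure dimension $n$ in $\mathbb P^N_K$, let $d=\sum_Z a_Z\deg Z$ be its degree and let $F_C=\prod_Z F_Z^{a_Z}$ be its Chow form. Here $F_Z\in K[u_{ij}:0\le i\le n,\ 0\le j\le N]$ is the irreducible polynomial that vanishes at $(u_0,\dots,u_n)$ exactly when $Z$ meets the intersection of the hyperplanes $u_0=0,\dots,u_n=0$ (over $\overline K$). The coefficients $z_\alpha$ of $F_C=\sum_\alpha z_\alpha u^\alpha$ are the homogeneous coordinates of the Chow point of $C$ in $Y=\mathbb P((\mathrm{Sym}^d V)^{\otimes(n+1)})$, $\dim V=N+1$. The group $\mathrm{SL}_{N+1}$ acts by $(gF)(u_0,\dots,u_n)=F(u_0g,\dots,u_ng)$, so that $gF_C$ is the Chow form of $gC$. The cycle $C$ is called semistable if, over $\overline K$, some $\mathrm{SL}_{N+1}$-invariant form of some degree $m>0$ in the coordinates $z_\alpha$ does not vanish at the Chow point of $C$. Let $s\in H^0(Y,\mathcal O_Y(m))$, $m>0$, be a form of degree $m$ in the $z_\alpha$ over $K$ with $s(C)\ne0$,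 where $s(C)$ denotes the value of $s$ at the coefficients of $F_C$. For a finite place $v$, extend the normalized absolute value $|\cdot|_v$ (for which a uniformizer has absolute value the inverse of the number of elements of the residue field) to $\overline{K_v}$, and for $g\in \mathrm{SL}_{N+1}(\overline{K_v})$ put $$\lambda_{s,v}(g)=-\frac1m\log\frac{|s(C)|_v}{\big(\max_\alpha|(gF_C)_\alpha|_v\big)^m}.$$ For an infinite place $v$, embed $K$ in $\mathbb C$ by $v$, and for $g\in\mathrm{SL}_{N+1}(\mathbb C)$ put $$\lambda_{s,v}(g)=-\frac1m\log|s(C)|+\frac12d(n+1)\sum_{j=1}^N\frac1j+\int_{S(\mathbb C^{N+1})^{n+1}}\log|gF_C(x)|\,dx,$$ where $dx$ is the product of the unitarily invariant probability measures on the unit spheres. (If $s$ is invariant then $s(C)$ is the value of $s$ at $gF_C$, and $\lambda_{s,v}(g)=-\frac1m\log\|s\|_v^m(g\cdot C)$; in general $s$ is transported along $g$ together with $C$.) The GIT height is $$\hat h_s(C)=\frac1{[K:\mathbb Q]}\Big(\sum_{v\nmid\infty}\inf_g\lambda_{s,v}(g)+\sum_{v\mid\infty}[K_v:\mathbb R]\inf_g\lambda_{s,v}(g)\Big).$$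 **Proposition.** Let $C_1,C_2$ be semistable effective cycles of pure dimension $n$ in $\mathbb P^N_K$, and let $s_1,s_2,s$ be any forms as above (of any positive degrees) that do not vanish at the Chow points of $C_1$, $C_2$, $C_1+C_2$ respectively. Then 1. all three heights are well defined: for each of the three pairs $(C_1,s_1)$, $(C_2,s_2)$, $(C_1+C_2,s)$ the functions $\log|gF|$ are integrable, all infima are finite, and all but finitely many finite places contribute $0$; 2. $\hat h_s(C_1+C_2)\ge\hat h_{s_1}(C_1)+\hat h_{s_2}(C_2)$; 3. if equality holds in 2, then at each place $v$ of $K$, every $g\in\mathrm{SL}_{N+1}(\overline{K_v})$ (with $\overline{K_v}=\mathbb C$ for infinite $v$) that minimizes $\lambda_{s,v}$ also minimizes $\lambda_{s_1,v}$ and $\lambda_{s_2,v}$. -/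

import Mathlib

open MeasureTheory

attribute [local instance] MvPolynomial.gradedAlgebra

noncomputable section

namespace GITHeight

/-! ### Effective cycles in projective space -/

/-- An `n`-dimensional closed subvariety (integral closed subscheme) of `ℙ^N` over `K`, given by its
generic point: a relevant homogeneous prime ideal of `K[x_0, …, x_N]` whose closure in
`Proj K[x_0, …, x_N]` has dimension `n`. -/
def Subvariety (K : Type*) [Field K] (n N : ℕ) : Type _ :=
  {p : ProjectiveSpectrum (MvPolynomial.homogeneousSubmodule (Fin (N + 1)) K) //
    topologicalKrullDim (closure ({p} : Set (ProjectiveSpectrum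
      (MvPolynomial.homogeneousSubmodule (Fin (N + 1)) K)))) = n}

/-- Effective cycles of pure dimension `n` in `ℙ^N` over `K`. -/
abbrev EffectiveCycle (K : Type*) [Field K] (n N : ℕ) : Type _ := Subvariety K n N →₀ ℕ

section Cycles

variable {K : Type*} [Field K] {n N : ℕ}

/-- The homogeneous prime ideal of a subvariety. -/
def Subvariety.ideal (Z : Subvariety K n N) : Ideal (MvPolynomial (Fin (N + 1)) K) :=
  Z.1.asHomogeneousIdeal.toIdeal

/-- The Hilbert function `t ↦ dim_K (K[x] / I_Z)_t`. -/
def Subvariety.hilbertFunction (Z : Subvariety K n N) (t : ℕ) : ℕ :=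
  Module.finrank K (MvPolynomial.homogeneousSubmodule (Fin (N + 1)) K t ⧸
    (Z.ideal.restrictScalars K).comap
      (MvPolynomial.homogeneousSubmodule (Fin (N + 1)) K t).subtype)

open Classical in
/-- The degree `(Z · 𝒪(1)^n)` of `Z`: the natural number `e` such that the Hilbert function is
asymptotic to `e t^n / n!`. -/
def Subvariety.degree (Z : Subvariety K n N) : ℕ :=
  if h : ∃ e : ℕ, Filter.Tendsto
      (fun t : ℕ => (n.factorial : ℝ) * (Z.hilbertFunction t : ℝ) / (t : ℝ) ^ n)
      Filter.atTop (nhds (e : ℝ))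
  then h.choose else 0

/-- `z` is a geometric point of (the affine cone over) `Z`. -/
def Subvariety.HasPoint (Z : Subvariety K n N) (z : Fin (N + 1) → AlgebraicClosure K) : Prop :=
  z ≠ 0 ∧ ∀ f ∈ Z.ideal, MvPolynomial.aeval z f = 0

/-- `F`, a polynomial in the coefficients `u_{ij}` of `n + 1` linear forms on `ℙ^N`, is a Chow form
of `Z`: it is irreducible over `K`, and it vanishes at `(u_0, …, u_n)` exactly when `Z` meets the
intersection of the hyperplanes `u_0 = 0, …, u_n = 0`. Over a field of characteristic zero each `Z`
has a Chow form, unique up to a nonzero constant. -/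
def IsChowForm (Z : Subvariety K n N) (F : MvPolynomial (Fin (n + 1) × Fin (N + 1)) K) : Prop :=
  Irreducible F ∧ ∀ u : Fin (n + 1) × Fin (N + 1) → AlgebraicClosure K,
    MvPolynomial.aeval u F = 0 ↔ ∃ z, Z.HasPoint z ∧ ∀ i, ∑ j, u (i, j) * z j = 0

open Classical in
/-- A Chow form of the subvariety `Z`. -/
def Subvariety.chowForm (Z : Subvariety K n N) : MvPolynomial (Fin (n + 1) × Fin (N + 1)) K :=
  if h : ∃ F, IsChowForm Z F then h.choose else 1

/-- The degree of a cycle. -/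
def degree (C : EffectiveCycle K n N) : ℕ := C.sum fun Z a => a * Z.degree

/-- The Chow form of a cycle `∑ a_Z Z` is `∏ F_Z ^ a_Z`. -/
def chowForm (C : EffectiveCycle K n N) : MvPolynomial (Fin (n + 1) × Fin (N + 1)) K :=
  C.prod fun Z a => Z.chowForm ^ a

end Cycles

/-! ### The Chow space and the action of `SL_{N+1}` -/

/-- The multidegree on polynomials in the `u_{ij}`: the variable `u_{ij}` has multidegree the `i`-th
unit vector of `ℕ^{n+1}`. -/
def multiWeight (n N : ℕ) : Fin (n + 1) × Fin (N + 1) → (Fin (n + 1) → ℕ) :=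
  fun ij => Pi.single ij.1 1

/-- The exponents `α` with `∑_j α_{ij} = d` for every `i`. They index the homogeneous coordinates
`z_α` on `Y = ℙ((Sym^d V)^{⊗ (n+1)})`. -/
def ChowIndex (n N d : ℕ) : Type :=
  {α : Fin (n + 1) × Fin (N + 1) →₀ ℕ // Finsupp.weight (multiWeight n N) α = fun _ => d}

section Chow

variable {L : Type*} [Field L] {n N : ℕ}

/-- The coordinates `z_α` of a polynomial `∑_α z_α u^α`. -/
def chowCoord (d : ℕ) (F : MvPolynomial (Fin (n + 1) × Fin (N + 1)) L) : ChowIndex n N d → L :=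
  fun α => F.coeff α.1

/-- The action of `g ∈ SL_{N+1}` on Chow forms, `(g F)(u_0, …, u_n) = F(u_0 g, …, u_n g)`. If `F` is
the Chow form of a cycle `X`, then `g F` is the Chow form of `g X`. -/
def slAct (g : Matrix.SpecialLinearGroup (Fin (N + 1)) L)
    (F : MvPolynomial (Fin (n + 1) × Fin (N + 1)) L) :
    MvPolynomial (Fin (n + 1) × Fin (N + 1)) L :=
  MvPolynomial.aeval (fun ij : Fin (n + 1) × Fin (N + 1) =>
    ∑ k, MvPolynomial.C (g.1 k ij.2) * MvPolynomial.X (ij.1, k)) F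

/-- A polynomial `s` in the `z_α` is `SL_{N+1}(L)`-invariant on `(Sym^d V)^{⊗ (n+1)}`. -/
def IsInvariant {d : ℕ} (s : MvPolynomial (ChowIndex n N d) L) : Prop :=
  ∀ (g : Matrix.SpecialLinearGroup (Fin (N + 1)) L)
    (F : MvPolynomial (Fin (n + 1) × Fin (N + 1)) L),
    MvPolynomial.IsWeightedHomogeneous (multiWeight n N) F (fun _ => d) →
    MvPolynomial.eval (chowCoord d (slAct g F)) s = MvPolynomial.eval (chowCoord d F) s

end Chow

/-- (Chow) semistability: some invariant section of `𝒪_Y(m)`, `m > 0`, over the algebraic closure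
does not vanish at the Chow point. The nonvanishing locus of such a section is automatically affine,
because `Y` is a projective space and `m > 0`. -/
def IsSemistable {K : Type*} [Field K] {n N : ℕ} (C : EffectiveCycle K n N) : Prop :=
  ∃ m : ℕ, 0 < m ∧ ∃ s : MvPolynomial (ChowIndex n N (degree C)) (AlgebraicClosure K),
    s.IsHomogeneous m ∧ IsInvariant s ∧
    MvPolynomial.eval (chowCoord (degree C)
      (MvPolynomial.map (algebraMap K (AlgebraicClosure K)) (chowForm C))) s ≠ 0

/-- A section `s ∈ H^0(Y, 𝒪_Y(m))`, `m > 0`, over `K`, that does not vanish at the Chow point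
of `C`. -/
structure NonvanishingSection {K : Type*} [Field K] {n N : ℕ} (C : EffectiveCycle K n N) where
  /-- the degree `m` -/
  m : ℕ
  m_pos : 0 < m
  /-- the section, a form of degree `m` in the coordinates `z_α` -/
  poly : MvPolynomial (ChowIndex n N (degree C)) K
  isHomogeneous : poly.IsHomogeneous m
  ne_zero : MvPolynomial.eval (chowCoord (degree C) (chowForm C)) poly ≠ 0

/-- The value `s(X)` at the Chow point. -/
def NonvanishingSection.value {K : Type*} [Field K] {n N : ℕ} {C : EffectiveCycle K n N}
    (s : NonvanishingSection C) : K :=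
  MvPolynomial.eval (chowCoord (degree C) (chowForm C)) s.poly

lemma eval_map_chowCoord {K : Type*} [Field K] {n N : ℕ} {C : EffectiveCycle K n N}
    {L : Type*} [Field L] (φ : K →+* L) (s : NonvanishingSection C) :
    MvPolynomial.eval (chowCoord (degree C) (MvPolynomial.map φ (chowForm C)))
      (MvPolynomial.map φ s.poly) = φ s.value := by
  have h : chowCoord (degree C) (MvPolynomial.map φ (chowForm C)) =
      φ ∘ chowCoord (degree C) (chowForm C) := by
    funext α
    simp [chowCoord, MvPolynomial.coeff_map]
  rw [h, MvPolynomial.eval_map, NonvanishingSection.value, MvPolynomial.eval₂_comp]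

/-! ### The Chow metric -/

/-- The unitarily invariant probability measure on the unit sphere of `ℂ^{N+1}`. -/
def sphereMeasure (N : ℕ) :
    Measure (Metric.sphere (0 : EuclideanSpace ℂ (Fin (N + 1))) 1) :=
  let σ := ((volume : Measure (Fin (N + 1) → ℂ)).map
    (WithLp.toLp 2 : (Fin (N + 1) → ℂ) → EuclideanSpace ℂ (Fin (N + 1)))).toSphere
  (σ Set.univ)⁻¹ • σ

/-- The function `x ↦ log |F(x)|` on `S(ℂ^{N+1})^{n+1}`. -/
def logAbs {n N : ℕ} (F : MvPolynomial (Fin (n + 1) × Fin (N + 1)) ℂ)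
    (x : Fin (n + 1) → Metric.sphere (0 : EuclideanSpace ℂ (Fin (N + 1))) 1) : ℝ :=
  Real.log ‖MvPolynomial.eval (fun ij : Fin (n + 1) × Fin (N + 1) => (x ij.1).1 ij.2) F‖

/-- For `F = ∑ z_α x_α` of multidegree `(d, …, d)`, the quantity `log |s(z)| - log ‖s‖_Ch(z)`, `s` a
section of `𝒪_Y(1)`. -/
def logChowNorm {n N : ℕ} (d : ℕ) (F : MvPolynomial (Fin (n + 1) × Fin (N + 1)) ℂ) : ℝ :=
  1 / 2 * d * (n + 1) * ∑ j ∈ Finset.Icc 1 N, (1 / j : ℝ) +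
    ∫ x, logAbs F x ∂(Measure.pi fun _ : Fin (n + 1) => sphereMeasure N)

/-! ### Local contributions and the height -/

section Height

open IsDedekindDomain NumberField

variable {K : Type*} [Field K] [NumberField K] {n N : ℕ} {C : EffectiveCycle K n N}

/-- The algebraic closure of the completion of `K` at a finite place. -/
abbrev FinAlgCl (v : HeightOneSpectrum (𝓞 K)) : Type _ := AlgebraicClosure (v.adicCompletion K)

/-- The extension to `FinAlgCl v` of the normalized `v`-adic absolute value (a uniformizer of `K_v`
has absolute value `1 / #(residue field)`). -/
def finAbs (v : HeightOneSpectrum (𝓞 K)) (x : FinAlgCl v) : ℝ :=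
  spectralNorm (v.adicCompletion K) (FinAlgCl v) x

/-- The embedding of `K` in `FinAlgCl v`. -/
def finEmb (v : HeightOneSpectrum (𝓞 K)) : K →+* FinAlgCl v :=
  (algebraMap (v.adicCompletion K) (FinAlgCl v)).comp (algebraMap K (v.adicCompletion K))

/-- `max_α |z_α|_v` for `∑_α z_α u^α`. -/
def finMax (v : HeightOneSpectrum (𝓞 K))
    (F : MvPolynomial (Fin (n + 1) × Fin (N + 1)) (FinAlgCl v)) : ℝ :=
  ⨆ α : Fin (n + 1) × Fin (N + 1) →₀ ℕ, finAbs v (F.coeff α)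

/-- The Chow form of `g X` at a finite place. -/
def finOrbit (C : EffectiveCycle K n N) (v : HeightOneSpectrum (𝓞 K))
    (g : Matrix.SpecialLinearGroup (Fin (N + 1)) (FinAlgCl v)) :
    MvPolynomial (Fin (n + 1) × Fin (N + 1)) (FinAlgCl v) :=
  slAct g (MvPolynomial.map (finEmb v) (chowForm C))

/-- The Chow form of `g X` at an infinite place. -/
def infOrbit (C : EffectiveCycle K n N) (v : InfinitePlace K)
    (g : Matrix.SpecialLinearGroup (Fin (N + 1)) ℂ) :
    MvPolynomial (Fin (n + 1) × Fin (N + 1)) ℂ :=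
  slAct g (MvPolynomial.map v.embedding (chowForm C))

/-- The function `g ↦ - log ‖s‖^m_v(g X) / m` on `SL_{N+1}` at a finite place `v`. Here `g` moves the
section together with the cycle, `(g s)(g X) = s(X)`; for an invariant section `g s = s`, see
`finLocal_eq`. -/
def finLocal (s : NonvanishingSection C) (v : HeightOneSpectrum (𝓞 K))
    (g : Matrix.SpecialLinearGroup (Fin (N + 1)) (FinAlgCl v)) : ℝ :=
  -Real.log (finAbs v (finEmb v s.value) / finMax v (finOrbit C v g) ^ s.m) / s.m

/-- The function `g ↦ - log ‖s‖^m_v(g X) / m` on `SL_{N+1}` at an infinite place `v`, for the Chow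
metric. As before, `g` moves the section together with the cycle. -/
def infLocal (s : NonvanishingSection C) (v : InfinitePlace K)
    (g : Matrix.SpecialLinearGroup (Fin (N + 1)) ℂ) : ℝ :=
  -(Real.log ‖v.embedding s.value‖ - s.m * logChowNorm (degree C) (infOrbit C v g)) / s.m

/-- For a section that `g` leaves unchanged at `X`, the local function is computed from the value of
`s` itself at `g X`. -/
lemma finLocal_eq (s : NonvanishingSection C) (v : HeightOneSpectrum (𝓞 K))
    (g : Matrix.SpecialLinearGroup (Fin (N + 1)) (FinAlgCl v))
    (h : MvPolynomial.eval (chowCoord (degree C) (finOrbit C v g))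
        (MvPolynomial.map (finEmb v) s.poly) =
      MvPolynomial.eval (chowCoord (degree C) (MvPolynomial.map (finEmb v) (chowForm C)))
        (MvPolynomial.map (finEmb v) s.poly)) :
    finLocal s v g = -Real.log (finAbs v (MvPolynomial.eval (chowCoord (degree C)
      (finOrbit C v g)) (MvPolynomial.map (finEmb v) s.poly)) /
        finMax v (finOrbit C v g) ^ s.m) / s.m := by
  rw [h, eval_map_chowCoord, finLocal]

/-- The analogue of `finLocal_eq` at an infinite place. -/
lemma infLocal_eq (s : NonvanishingSection C) (v : InfinitePlace K)
    (g : Matrix.SpecialLinearGroup (Fin (N + 1)) ℂ)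
    (h : MvPolynomial.eval (chowCoord (degree C) (infOrbit C v g))
        (MvPolynomial.map v.embedding s.poly) =
      MvPolynomial.eval (chowCoord (degree C) (MvPolynomial.map v.embedding (chowForm C)))
        (MvPolynomial.map v.embedding s.poly)) :
    infLocal s v g = -(Real.log ‖MvPolynomial.eval (chowCoord (degree C) (infOrbit C v g))
      (MvPolynomial.map v.embedding s.poly)‖ -
        s.m * logChowNorm (degree C) (infOrbit C v g)) / s.m := by
  rw [h, eval_map_chowCoord, infLocal]

/-- The GIT height, computed with the section `s`. The factor `v.mult` (`1` for real and `2` for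
complex places) normalizes the infinite places. -/
def gitHeight (s : NonvanishingSection C) : ℝ :=
  ((∑ᶠ v : HeightOneSpectrum (𝓞 K), ⨅ g, finLocal s v g) +
    ∑ v : InfinitePlace K, (v.mult : ℝ) * ⨅ g, infLocal s v g) / Module.finrank ℚ K

/-- All the integrals, infima and sums in the definition of the height exist as real numbers. -/
structure HeightConverges (s : NonvanishingSection C) : Prop where
  bddBelow_fin : ∀ v : HeightOneSpectrum (𝓞 K), BddBelow (Set.range (finLocal s v))
  bddBelow_inf : ∀ v : InfinitePlace K, BddBelow (Set.range (infLocal s v))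
  integrable : ∀ (v : InfinitePlace K) (g : Matrix.SpecialLinearGroup (Fin (N + 1)) ℂ),
    Integrable (logAbs (infOrbit C v g)) (Measure.pi fun _ : Fin (n + 1) => sphereMeasure N)
  finite_support : (Function.support fun v : HeightOneSpectrum (𝓞 K) => ⨅ g, finLocal s v g).Finite

/-- `g` minimizes the local contribution at a finite place. -/
def IsFinMinimizer (s : NonvanishingSection C) (v : HeightOneSpectrum (𝓞 K))
    (g : Matrix.SpecialLinearGroup (Fin (N + 1)) (FinAlgCl v)) : Prop :=
  ∀ g', finLocal s v g ≤ finLocal s v g'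

/-- `g` minimizes the local contribution at an infinite place. -/
def IsInfMinimizer (s : NonvanishingSection C) (v : InfinitePlace K)
    (g : Matrix.SpecialLinearGroup (Fin (N + 1)) ℂ) : Prop :=
  ∀ g', infLocal s v g ≤ infLocal s v g'

end Height

end GITHeight

end

open GITHeight

/-!
The local function of a cycle `C` at a place `v` is a constant, `-(1/m) log |s(C)|_v`, plus a
function of `g` that does not involve the section: `finLogMax`, the logarithm of the Gauss norm of
the Chow form of `g C`, at a finite place, and `infLogNorm`, essentially the integral of the
logarithm of that Chow form over a product of spheres, at an infinite place. By the product formula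
the constants drop out of the height (`OrbitBounds.gitHeight_eq`).

The Chow form of `C₁ + C₂` is the product of the Chow forms of `C₁` and `C₂`, and `g` acts by a ring
homomorphism. The Gauss norm is multiplicative (`coeffMax_mul`) and so is `|F|` under the integral,
hence the functions of `g` add up at every place. The infimum of a sum is at least the sum of the
infima, which gives the inequality. If the heights agree then so do the infima at each place, and a
minimizer of the sum has to minimize both summands (`minimizer_of_ciInf_add_eq`).

What remains is the convergence of the heights.

* Chow forms are multihomogeneous: the zero locus is stable under rescaling each row of variables,
  and a polynomial with a zero locus stable under a torus is homogeneous for its weights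
  (`isWeightedHomogeneous_of_eval_eq_zero`).
* An invariant form `I` over the algebraic closure of `K` keeps, up to a root of unity, its value on
  the orbit of the Chow form under `SL_{N+1}` of any larger field, because the invariance is a
  polynomial identity in the entries of the matrix (`evalCoeffs_rowSubst_pow`). Semistability thus
  bounds the coefficients of the Chow form of `g C` away from zero. At a finite place at which the
  coefficients of `I` and of the Chow form are integral and the value of `I` is a unit, the minimum
  of `finLogMax` is `0`; this applies to almost all places.
* At an infinite place, `exists_log_sub_le_integral_logAbs` shows that `log |F|` is integrable and
  bounds its integral below by the logarithm of the maximum of `|F|` on the unit polydisc. Since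
  `log |F|` is plurisubharmonic, the mean value inequality holds on a polydisc centred at a point
  where that maximum is attained and large enough to contain the unit polydisc; homogeneity bounds
  `|F|` above there, and radial projection carries the estimate to the spheres.
-/

namespace GITHeight

open MvPolynomial

/-! ### Multihomogeneous polynomials and linear substitutions -/

lemma weight_multiWeight_apply {n N : ℕ} (α : Fin (n + 1) × Fin (N + 1) →₀ ℕ) (i : Fin (n + 1)) :
    Finsupp.weight (multiWeight n N) α i = ∑ j, α (i, j) := by
  rw [Finsupp.weight_apply, Finsupp.sum_fintype _ _ (by simp), Finset.sum_apply,
    Fintype.sum_prod_type, Finset.sum_eq_single i]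
  · simp [multiWeight]
  · intro b _ hb
    simp [multiWeight, hb.symm]
  · simp

section Substitution

variable {R S : Type*} [CommRing R] [CommRing S] {n N d : ℕ}

/-- The substitution `F(u_0, …, u_n) ↦ F(u_0 A, …, u_n A)` for a square matrix `A` over a
commutative ring. For `A ∈ SL_{N+1}` over a field it is `slAct A`. -/
noncomputable def rowSubst (A : Matrix (Fin (N + 1)) (Fin (N + 1)) R) :
    MvPolynomial (Fin (n + 1) × Fin (N + 1)) R →ₐ[R] MvPolynomial (Fin (n + 1) × Fin (N + 1)) R :=
  aeval fun ij => ∑ k, C (A k ij.2) * X (ij.1, k)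

lemma slAct_eq_rowSubst {L : Type*} [Field L] (g : Matrix.SpecialLinearGroup (Fin (N + 1)) L)
    (F : MvPolynomial (Fin (n + 1) × Fin (N + 1)) L) : slAct g F = rowSubst g.1 F := rfl

lemma rowSubst_C (A : Matrix (Fin (N + 1)) (Fin (N + 1)) R) (a : R) :
    rowSubst (n := n) A (C a) = C a := aeval_C _ a

lemma rowSubst_X (A : Matrix (Fin (N + 1)) (Fin (N + 1)) R) (ij : Fin (n + 1) × Fin (N + 1)) :
    rowSubst A (X ij) = ∑ k, C (A k ij.2) * X (ij.1, k) := aeval_X _ ij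

lemma map_rowSubst (ψ : R →+* S) (A : Matrix (Fin (N + 1)) (Fin (N + 1)) R)
    (F : MvPolynomial (Fin (n + 1) × Fin (N + 1)) R) :
    map ψ (rowSubst A F) = rowSubst (A.map ψ) (map ψ F) := by
  induction F using MvPolynomial.induction_on with
  | C a => simp
  | add p q hp hq => simp [hp, hq]
  | mul_X p i hp => simp [hp, rowSubst_X]

lemma rowSubst_rowSubst (A B : Matrix (Fin (N + 1)) (Fin (N + 1)) R)
    (F : MvPolynomial (Fin (n + 1) × Fin (N + 1)) R) :
    rowSubst A (rowSubst B F) = rowSubst (A * B) F := by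
  induction F using MvPolynomial.induction_on with
  | C a => simp
  | add p q hp hq => simp [hp, hq]
  | mul_X p i hp =>
    rw [map_mul, map_mul, hp, map_mul]
    congr 1
    simp only [rowSubst_X, rowSubst_C, map_sum, map_mul, Matrix.mul_apply,
      Finset.sum_mul, Finset.mul_sum]
    rw [Finset.sum_comm]
    refine Finset.sum_congr rfl fun k _ => Finset.sum_congr rfl fun l _ => ?_
    ring

lemma rowSubst_one (F : MvPolynomial (Fin (n + 1) × Fin (N + 1)) R) :
    rowSubst (1 : Matrix (Fin (N + 1)) (Fin (N + 1)) R) F = F := by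
  have h : rowSubst (n := n) (1 : Matrix (Fin (N + 1)) (Fin (N + 1)) R) = AlgHom.id R _ := by
    ext ij : 1
    simp [rowSubst_X, Matrix.one_apply]
  rw [h, AlgHom.id_apply]

lemma isWeightedHomogeneous_rowSubst (A : Matrix (Fin (N + 1)) (Fin (N + 1)) R)
    {F : MvPolynomial (Fin (n + 1) × Fin (N + 1)) R} {e : Fin (n + 1) → ℕ}
    (hF : IsWeightedHomogeneous (multiWeight n N) F e) :
    IsWeightedHomogeneous (multiWeight n N) (rowSubst A F) e := by
  rw [rowSubst, aeval_def, eval₂_eq']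
  refine IsWeightedHomogeneous.sum _ _ _ fun α hα => ?_
  rw [algebraMap_eq]
  refine IsWeightedHomogeneous.C_mul ?_ _
  have h := IsWeightedHomogeneous.prod (w := multiWeight n N) Finset.univ
    (fun ij => (∑ k, C (A k ij.2) * X (ij.1, k) :
      MvPolynomial (Fin (n + 1) × Fin (N + 1)) R) ^ α ij)
    (fun ij => α ij • multiWeight n N ij) fun ij _ => by
      refine IsWeightedHomogeneous.pow (IsWeightedHomogeneous.sum _ _ _ fun k _ => ?_) _
      exact (isWeightedHomogeneous_X R (multiWeight n N) (ij.1, k)).C_mul _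
  convert h
  rw [← hF (mem_support_iff.1 hα), Finsupp.weight_apply, Finsupp.sum_fintype _ _ (by simp)]

/-- Scaling the `i`-th row of variables by `r i` multiplies a form of multidegree `(d, …, d)` by
`(∏ i, r i) ^ d`. -/
lemma aeval_scale_rows {A : Type*} [CommRing A] [Algebra R A]
    {F : MvPolynomial (Fin (n + 1) × Fin (N + 1)) R}
    (hF : IsWeightedHomogeneous (multiWeight n N) F fun _ => d)
    (r : Fin (n + 1) → A) (x : Fin (n + 1) × Fin (N + 1) → A) :
    aeval (fun ij => r ij.1 * x ij) F = (∏ i, r i) ^ d * aeval x F := by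
  rw [aeval_def, eval₂_eq', aeval_def, eval₂_eq', Finset.mul_sum]
  refine Finset.sum_congr rfl fun α hα => ?_
  have hw := hF (mem_support_iff.1 hα)
  have h : ∏ ij : Fin (n + 1) × Fin (N + 1), r ij.1 ^ α ij = (∏ i, r i) ^ d := by
    rw [Fintype.prod_prod_type, ← Finset.prod_pow]
    refine Finset.prod_congr rfl fun i _ => ?_
    dsimp only
    rw [Finset.prod_pow_eq_pow_sum, ← weight_multiWeight_apply, hw]
  simp_rw [mul_pow, Finset.prod_mul_distrib, h]
  ring

lemma rowSubst_smul {F : MvPolynomial (Fin (n + 1) × Fin (N + 1)) R}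
    (hF : IsWeightedHomogeneous (multiWeight n N) F fun _ => d)
    (c : R) (A : Matrix (Fin (N + 1)) (Fin (N + 1)) R) :
    rowSubst (c • A) F = C (c ^ ((n + 1) * d)) * rowSubst A F := by
  have h := aeval_scale_rows hF (fun _ => (C c : MvPolynomial (Fin (n + 1) × Fin (N + 1)) R))
    fun ij => ∑ k, C (A k ij.2) * X (ij.1, k)
  simp only [Finset.prod_const, Finset.card_univ, Fintype.card_fin, ← pow_mul, ← C_pow] at h
  rw [rowSubst, rowSubst, ← h]
  congr 2
  funext ij
  simp [Finset.mul_sum, mul_assoc]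

/-- The value of a polynomial `I` in the coordinates `z_α` at the coefficients of `F`. -/
noncomputable def evalCoeffs (I : MvPolynomial (ChowIndex n N d) R)
    (F : MvPolynomial (Fin (n + 1) × Fin (N + 1)) R) : R :=
  eval (fun α : ChowIndex n N d => F.coeff α.1) I

lemma map_evalCoeffs (ψ : R →+* S) (I : MvPolynomial (ChowIndex n N d) R)
    (F : MvPolynomial (Fin (n + 1) × Fin (N + 1)) R) :
    ψ (evalCoeffs I F) = evalCoeffs (map ψ I) (map ψ F) := by
  simp only [evalCoeffs, coeff_map, eval_map]
  rw [← eval₂_id, hom_eval₂]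
  rfl

lemma evalCoeffs_C_mul {m : ℕ} {I : MvPolynomial (ChowIndex n N d) R} (hI : I.IsHomogeneous m)
    (c : R) (F : MvPolynomial (Fin (n + 1) × Fin (N + 1)) R) :
    evalCoeffs I (C c * F) = c ^ m * evalCoeffs I F := by
  rw [evalCoeffs, evalCoeffs, eval_eq, eval_eq, Finset.mul_sum]
  refine Finset.sum_congr rfl fun β hβ => ?_
  have h := hI (mem_support_iff.1 hβ)
  simp only [coeff_C_mul, mul_pow, Finset.prod_mul_distrib, Finset.prod_pow_eq_pow_sum]
  rw [← h, Finsupp.weight_apply, Finsupp.sum]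
  simp only [Pi.one_apply, smul_eq_mul, mul_one]
  ring

lemma map_det_mul_evalCoeffs_sub (ψ : R →+* S) (A : Matrix (Fin (N + 1)) (Fin (N + 1)) R)
    (I : MvPolynomial (ChowIndex n N d) R) (F : MvPolynomial (Fin (n + 1) × Fin (N + 1)) R)
    (c : R) (p q : ℕ) :
    ψ (A.det * (evalCoeffs I (rowSubst A F) ^ p - A.det ^ q * c ^ p)) =
      (A.map ψ).det * (evalCoeffs (map ψ I) (rowSubst (A.map ψ) (map ψ F)) ^ p -
        (A.map ψ).det ^ q * ψ c ^ p) := by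
  have hdet : ψ A.det = (A.map ψ).det := by rw [RingHom.map_det]; rfl
  simp only [map_mul, map_sub, map_pow, map_evalCoeffs, map_rowSubst, hdet]

end Substitution

/-! ### Invariance over extensions of the base field -/

section Transfer

variable {k L : Type*} [Field k] [IsAlgClosed k] [Field L] {n N d m : ℕ}

/-- Over an algebraically closed field every invertible matrix is a scalar multiple of a matrix in
`SL_{N+1}`, so an invariant form is multiplied by a power of the determinant, up to roots of
unity. The factor `det A` makes the identity polynomial in `A`, without case distinction. -/
lemma det_mul_evalCoeffs_rowSubst {I : MvPolynomial (ChowIndex n N d) k} (hI : I.IsHomogeneous m)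
    (hinv : IsInvariant I) {G : MvPolynomial (Fin (n + 1) × Fin (N + 1)) k}
    (hG : IsWeightedHomogeneous (multiWeight n N) G fun _ => d)
    (A : Matrix (Fin (N + 1)) (Fin (N + 1)) k) :
    A.det * (evalCoeffs I (rowSubst A G) ^ (N + 1) -
      A.det ^ ((n + 1) * d * m) * evalCoeffs I G ^ (N + 1)) = 0 := by
  by_cases hA : A.det = 0
  · rw [hA, zero_mul]
  obtain ⟨c, hc⟩ := IsAlgClosed.exists_pow_nat_eq A.det N.succ_pos
  have hc0 : c ≠ 0 := by
    rintro rfl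
    exact hA (by rw [← hc, zero_pow N.succ_ne_zero])
  have hdet : (c⁻¹ • A).det = 1 := by
    rw [Matrix.det_smul, Fintype.card_fin, ← hc, inv_pow, inv_mul_cancel₀ (pow_ne_zero _ hc0)]
  have hAc : A = c • (c⁻¹ • A) := by rw [smul_smul, mul_inv_cancel₀ hc0, one_smul]
  have h := hinv ⟨c⁻¹ • A, hdet⟩ G hG
  change evalCoeffs I (rowSubst (c⁻¹ • A) G) = evalCoeffs I G at h
  have h' : evalCoeffs I (rowSubst A G) = (c ^ ((n + 1) * d)) ^ m * evalCoeffs I G := by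
    conv_lhs => rw [hAc, rowSubst_smul hG, evalCoeffs_C_mul hI, h]
  rw [h', ← hc, mul_pow, ← pow_mul, ← pow_mul, ← pow_mul, Nat.succ_eq_add_one,
    mul_comm (N + 1) ((n + 1) * d * m), mul_assoc ((n + 1) * d) m, sub_self, mul_zero]

/-- An invariant form over an algebraically closed field `k` remains invariant, up to roots of
unity, under `SL_{N+1}` of every extension field: the polynomial identity behind invariance holds
for the generic matrix. -/
lemma evalCoeffs_rowSubst_pow {I : MvPolynomial (ChowIndex n N d) k} (hI : I.IsHomogeneous m)
    (hinv : IsInvariant I) {G : MvPolynomial (Fin (n + 1) × Fin (N + 1)) k}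
    (hG : IsWeightedHomogeneous (multiWeight n N) G fun _ => d)
    (φ : k →+* L) (g : Matrix.SpecialLinearGroup (Fin (N + 1)) L) :
    evalCoeffs (map φ I) (slAct g (map φ G)) ^ (N + 1) = φ (evalCoeffs I G) ^ (N + 1) := by
  let M : Matrix (Fin (N + 1)) (Fin (N + 1)) (MvPolynomial (Fin (N + 1) × Fin (N + 1)) k) :=
    Matrix.mvPolynomialX _ _ k
  have hzero : M.det * (evalCoeffs (map C I) (rowSubst M (map C G)) ^ (N + 1) -
      M.det ^ ((n + 1) * d * m) * C (evalCoeffs I G) ^ (N + 1)) = 0 := by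
    refine MvPolynomial.funext fun x => ?_
    have hid : (eval x).comp C = RingHom.id k := by ext; simp
    rw [map_det_mul_evalCoeffs_sub, map_map, map_map, hid, map_id, map_id, eval_C, map_zero]
    exact det_mul_evalCoeffs_rowSubst hI hinv hG _
  -- specialize the generic matrix to `g`
  have hM : M.map (eval₂Hom φ fun ij => g.1 ij.1 ij.2) = g.1 := by
    ext i j
    simp [M]
  have hcomp : (eval₂Hom φ fun ij : Fin (N + 1) × Fin (N + 1) => g.1 ij.1 ij.2).comp C = φ := by
    ext; simp
  have h := congrArg (eval₂Hom φ fun ij => g.1 ij.1 ij.2) hzero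
  rw [map_det_mul_evalCoeffs_sub, map_zero, map_map, map_map, hM, hcomp, g.2, one_mul, one_pow,
    one_mul, coe_eval₂Hom, eval₂_C] at h
  rw [slAct_eq_rowSubst]
  exact sub_eq_zero.1 h

end Transfer

/-! ### Chow forms -/

/-- A polynomial over an algebraically closed field whose vanishing at a nonzero point does not
depend on the point is a monomial. -/
lemma _root_.Polynomial.eq_C_mul_X_pow_of_eval_eq_zero_iff {k : Type*} [Field k] [IsAlgClosed k]
    (p : Polynomial k) (hp : ∀ x y : k, x ≠ 0 → y ≠ 0 → (p.eval x = 0 → p.eval y = 0)) :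
    ∃ (c : k) (e : ℕ), p = Polynomial.C c * Polynomial.X ^ e := by
  by_cases h0 : p = 0
  · exact ⟨0, 0, by simp [h0]⟩
  have hroot : ∀ x ∈ p.roots, x = 0 := by
    intro x hx
    by_contra hx0
    refine h0 (Polynomial.eq_zero_of_infinite_isRoot p ?_)
    refine (Set.infinite_univ.sdiff (Set.finite_singleton (0 : k))).mono fun y hy => ?_
    exact hp x y hx0 (by simpa using hy) (Polynomial.isRoot_of_mem_roots hx)
  refine ⟨p.leadingCoeff, Multiset.card p.roots, ?_⟩
  conv_lhs => rw [(IsAlgClosed.splits p).eq_prod_roots]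
  rw [Multiset.eq_replicate_of_mem hroot]
  simp

/-- A polynomial whose zero locus is stable under the one-parameter torus with weights `w` is
homogeneous for `w`. -/
lemma isWeightedHomogeneous_of_eval_eq_zero {k σ : Type*} [Field k] [IsAlgClosed k]
    (w : σ → ℕ) (F : MvPolynomial σ k)
    (hF : ∀ (u : σ → k) (r : k), r ≠ 0 → eval u F = 0 → eval (fun i => r ^ w i * u i) F = 0) :
    ∃ e, IsWeightedHomogeneous w F e := by
  classical
  by_contra! hne
  obtain ⟨α, hα, β, hβ, hab⟩ : ∃ α ∈ F.support, ∃ β ∈ F.support,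
      Finsupp.weight w α ≠ Finsupp.weight w β := by
    by_contra! hall
    rcases F.support.eq_empty_or_nonempty with h | ⟨α, hα⟩
    · exact hne 0 (by rw [support_eq_empty.1 h]; exact isWeightedHomogeneous_zero _ _ _)
    · exact hne _ fun β hβ => hall β (mem_support_iff.2 hβ) α hα
  have hcomp (γ : σ →₀ ℕ) (hγ : γ ∈ F.support) :
      weightedHomogeneousComponent w (Finsupp.weight w γ) F ≠ 0 := by
    refine fun h => mem_support_iff.1 hγ ?_
    have := coeff_weightedHomogeneousComponent (w := w) (n := Finsupp.weight w γ) γ (φ := F)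
    rw [h, coeff_zero, if_pos rfl] at this
    exact this.symm
  obtain ⟨u, hu⟩ : ∃ u, eval u (weightedHomogeneousComponent w (Finsupp.weight w α) F *
      weightedHomogeneousComponent w (Finsupp.weight w β) F) ≠ 0 := by
    by_contra! h
    exact mul_ne_zero (hcomp α hα) (hcomp β hβ) (MvPolynomial.funext fun u => by rw [h, map_zero])
  rw [map_mul] at hu
  -- `p(r) = F(r ^ w • u)`, whose coefficients are the values of the weighted components at `u`
  let p : Polynomial k := aeval (fun i => Polynomial.X ^ w i * Polynomial.C (u i)) F
  have hpe (r : k) : p.eval r = eval (fun i => r ^ w i * u i) F := by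
    rw [← Polynomial.coe_evalRingHom, show p = eval₂ Polynomial.C _ F from rfl, hom_eval₂]
    have : (Polynomial.evalRingHom r).comp Polynomial.C = RingHom.id k := by ext; simp
    rw [this, eval₂_id]
    simp only [Polynomial.coe_evalRingHom, Polynomial.eval_mul, Polynomial.eval_pow,
      Polynomial.eval_X, Polynomial.eval_C]
  have hpc (e : ℕ) : p.coeff e = eval u (weightedHomogeneousComponent w e F) := by
    rw [show p = eval₂ Polynomial.C _ F from rfl, eval₂_eq, Polynomial.finsetSum_coeff,
      weightedHomogeneousComponent_apply, map_sum, Finset.sum_filter]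
    refine Finset.sum_congr rfl fun γ _ => ?_
    have h1 : ∏ i ∈ γ.support, (Polynomial.X ^ w i * Polynomial.C (u i)) ^ γ i =
        Polynomial.C (∏ i ∈ γ.support, u i ^ γ i) * Polynomial.X ^ (Finsupp.weight w γ) := by
      simp only [mul_pow, Finset.prod_mul_distrib, ← pow_mul, Finset.prod_pow_eq_pow_sum,
        map_prod, map_pow]
      rw [mul_comm, Finsupp.weight_apply, Finsupp.sum]
      simp [mul_comm]
    rw [h1, ← mul_assoc, ← map_mul, Polynomial.coeff_C_mul_X_pow]
    by_cases h : Finsupp.weight w γ = e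
    · rw [if_pos h, if_pos h.symm, eval_monomial]
      rfl
    · rw [if_neg h, if_neg (Ne.symm h)]
  obtain ⟨c, e, hce⟩ := p.eq_C_mul_X_pow_of_eval_eq_zero_iff fun x y hx hy h => by
    rw [hpe] at h ⊢
    have := hF _ (y / x) (div_ne_zero hy hx) h
    convert this using 3
    funext i
    rw [div_pow, ← mul_assoc, div_mul_cancel₀ _ (pow_ne_zero _ hx)]
  have hcoeff (e' : ℕ) (h : p.coeff e' ≠ 0) : e' = e := by
    by_contra hne'
    exact h (by rw [hce, Polynomial.coeff_C_mul_X_pow, if_neg hne'])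
  refine hab ((hcoeff _ ?_).trans (hcoeff _ ?_).symm)
  · rw [hpc]; exact left_ne_zero_of_mul hu
  · rw [hpc]; exact right_ne_zero_of_mul hu

section ChowForm

variable {K : Type*} [Field K] {n N : ℕ}

lemma chowForm_add (C₁ C₂ : EffectiveCycle K n N) :
    chowForm (C₁ + C₂) = chowForm C₁ * chowForm C₂ := by
  classical
  exact Finsupp.prod_add_index' (by simp) (fun _ _ _ => pow_add _ _ _)

lemma degree_add (C₁ C₂ : EffectiveCycle K n N) :
    degree (C₁ + C₂) = degree C₁ + degree C₂ := by
  classical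
  exact Finsupp.sum_add_index' (by simp) (fun _ _ _ => add_mul _ _ _)

/-- A Chow form is multihomogeneous, because the hyperplane `u_i = 0` does not change when `u_i` is
multiplied by a nonzero constant. -/
lemma IsChowForm.exists_isWeightedHomogeneous {Z : Subvariety K n N}
    {F : MvPolynomial (Fin (n + 1) × Fin (N + 1)) K} (hF : IsChowForm Z F) :
    ∃ e, IsWeightedHomogeneous (multiWeight n N) F e := by
  have h (i : Fin (n + 1)) : ∃ e, IsWeightedHomogeneous
      (fun ij : Fin (n + 1) × Fin (N + 1) => if ij.1 = i then 1 else 0)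
      (map (algebraMap K (AlgebraicClosure K)) F) e := by
    refine isWeightedHomogeneous_of_eval_eq_zero _ _ fun u r hr hu => ?_
    rw [eval_map, ← aeval_def] at hu ⊢
    obtain ⟨z, hz, hzero⟩ := (hF.2 u).1 hu
    refine (hF.2 _).2 ⟨z, hz, fun i' => ?_⟩
    trans (r ^ if i' = i then 1 else 0) * ∑ j, u (i', j) * z j
    · rw [Finset.mul_sum]
      exact Finset.sum_congr rfl fun j _ => mul_assoc _ _ _
    · rw [hzero, mul_zero]
  choose e he using h
  refine ⟨e, fun α hα => _root_.funext fun i => ?_⟩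
  have hα' : coeff α (map (algebraMap K (AlgebraicClosure K)) F) ≠ 0 := by
    rw [coeff_map]
    exact (map_ne_zero _).2 hα
  rw [weight_multiWeight_apply, ← he i hα', Finsupp.weight_apply,
    Finsupp.sum_fintype _ _ (by simp), Fintype.sum_prod_type, Finset.sum_eq_single i]
  · simp
  · intro b _ hb
    simp [hb]
  · simp

lemma Subvariety.exists_isWeightedHomogeneous_chowForm (Z : Subvariety K n N) :
    ∃ e, IsWeightedHomogeneous (multiWeight n N) Z.chowForm e := by
  rw [Subvariety.chowForm]
  split_ifs with h
  · exact h.choose_spec.exists_isWeightedHomogeneous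
  · exact ⟨0, isWeightedHomogeneous_one _ _⟩

lemma Subvariety.chowForm_ne_zero (Z : Subvariety K n N) : Z.chowForm ≠ 0 := by
  rw [Subvariety.chowForm]
  split_ifs with h
  · exact h.choose_spec.1.ne_zero
  · exact one_ne_zero

lemma chowForm_ne_zero (C : EffectiveCycle K n N) : chowForm C ≠ 0 :=
  Finset.prod_ne_zero_iff.2 fun Z _ => pow_ne_zero _ Z.chowForm_ne_zero

/-- The Chow form has multidegree `(d, …, d)` for `d` the degree of the cycle: it is
multihomogeneous of some multidegree, and a section that does not vanish at it detects a
coefficient of multidegree `(d, …, d)`. -/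
lemma NonvanishingSection.isWeightedHomogeneous_chowForm {C : EffectiveCycle K n N}
    (s : NonvanishingSection C) :
    IsWeightedHomogeneous (multiWeight n N) (chowForm C) fun _ => degree C := by
  choose e he using fun Z : Subvariety K n N => Z.exists_isWeightedHomogeneous_chowForm
  have h : IsWeightedHomogeneous (multiWeight n N) (chowForm C) (∑ Z ∈ C.support, C Z • e Z) :=
    IsWeightedHomogeneous.prod _ _ _ fun Z _ => (he Z).pow _
  obtain ⟨α, hα⟩ : ∃ α, chowCoord (degree C) (chowForm C) α ≠ 0 := by
    by_contra! h0
    refine s.ne_zero ?_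
    have h1 := evalCoeffs_C_mul s.isHomogeneous 0 (chowForm C)
    rw [zero_pow s.m_pos.ne', zero_mul, C_0, zero_mul] at h1
    rw [show chowCoord (degree C) (chowForm C) = chowCoord (degree C) 0 from
      _root_.funext fun α => by rw [h0 α]; rfl]
    exact h1
  rwa [← α.2, h hα]

end ChowForm

end GITHeight

namespace GITHeight

open MvPolynomial

/-! ### The Gauss norm of a nonarchimedean absolute value -/

section GaussNorm

variable {L σ : Type*} [Field L]

/-- The maximum of the absolute values of the coefficients of a polynomial (the Gauss norm). -/
noncomputable def coeffMax (a : AbsoluteValue L ℝ) (F : MvPolynomial σ L) : ℝ :=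
  ⨆ α : σ →₀ ℕ, a (F.coeff α)

lemma exists_coeffMax_eq (a : AbsoluteValue L ℝ) (F : MvPolynomial σ L) :
    ∃ α, coeffMax a F = a (F.coeff α) ∧ ∀ β, a (F.coeff β) ≤ a (F.coeff α) := by
  classical
  obtain ⟨α, hα⟩ : ∃ α, ∀ β, a (F.coeff β) ≤ a (F.coeff α) := by
    rcases F.support.eq_empty_or_nonempty with h | h
    · exact ⟨0, fun β => by simp [support_eq_empty.1 h]⟩
    · obtain ⟨α, -, hα⟩ := F.support.exists_max_image (fun β => a (F.coeff β)) h
      refine ⟨α, fun β => ?_⟩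
      by_cases hβ : β ∈ F.support
      · exact hα β hβ
      · rw [notMem_support_iff.1 hβ, map_zero]
        exact a.nonneg _
  exact ⟨α, le_antisymm (ciSup_le hα) (le_ciSup (f := fun β => a (F.coeff β))
    ⟨_, Set.forall_mem_range.2 hα⟩ α), hα⟩

lemma le_coeffMax (a : AbsoluteValue L ℝ) (F : MvPolynomial σ L) (α : σ →₀ ℕ) :
    a (F.coeff α) ≤ coeffMax a F := by
  obtain ⟨β, hβ, h⟩ := exists_coeffMax_eq a F
  exact hβ ▸ h α

lemma coeffMax_nonneg (a : AbsoluteValue L ℝ) (F : MvPolynomial σ L) : 0 ≤ coeffMax a F :=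
  (a.nonneg _).trans (le_coeffMax a F 0)

lemma coeffMax_pos (a : AbsoluteValue L ℝ) {F : MvPolynomial σ L} (hF : F ≠ 0) :
    0 < coeffMax a F := by
  obtain ⟨α, hα⟩ := ne_zero_iff.1 hF
  exact (a.pos hα).trans_le (le_coeffMax a F α)

/-- Gauss's lemma. Among the pairs of exponents where `F` and `G` attain their maxima there is one
whose sum arises from no other such pair, and the coefficient of `F * G` there has the expected
absolute value. -/
lemma coeffMax_mul {a : AbsoluteValue L ℝ} (ha : IsNonarchimedean a) (F G : MvPolynomial σ L) :
    coeffMax a (F * G) = coeffMax a F * coeffMax a G := by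
  classical
  by_cases hF : F = 0
  · simp [hF, coeffMax]
  by_cases hG : G = 0
  · simp [hG, coeffMax]
  have hF0 := coeffMax_pos a hF
  have hG0 := coeffMax_pos a hG
  refine le_antisymm (ciSup_le fun γ => ?_) ?_
  · rw [coeff_mul]
    refine (ha.apply_sum_le).trans (Real.iSup_le (fun p => ?_) (by positivity))
    rw [map_mul]
    exact mul_le_mul (le_coeffMax _ _ _) (le_coeffMax _ _ _) (a.nonneg _) hF0.le
  · have hne (H : MvPolynomial σ L) (hH : 0 < coeffMax a H) :
        (H.support.filter fun α => a (H.coeff α) = coeffMax a H).Nonempty := by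
      obtain ⟨α, hα, -⟩ := exists_coeffMax_eq a H
      refine ⟨α, Finset.mem_filter.2 ⟨mem_support_iff.2 fun h => ?_, hα.symm⟩⟩
      rw [hα, h, map_zero] at hH
      exact hH.false
    obtain ⟨α, hα, β, hβ, huniq⟩ := UniqueSums.uniqueAdd_of_nonempty (hne F hF0) (hne G hG0)
    rw [Finset.mem_filter] at hα hβ
    have h : a ((F * G).coeff (α + β)) = a (F.coeff α * G.coeff β) := by
      rw [coeff_mul]
      refine ha.apply_sum_eq_of_lt (k := (α, β)) (fun x => (a.map_neg x).symm)
        (Finset.HasAntidiagonal.mem_antidiagonal.2 rfl) fun p hp hpne => ?_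
      rw [map_mul, map_mul, hα.2, hβ.2]
      rcases (le_coeffMax a F p.1).lt_or_eq with h1 | h1
      · exact (mul_le_mul_of_nonneg_left (le_coeffMax a G p.2) (a.nonneg _)).trans_lt
          (mul_lt_mul_of_pos_right h1 hG0)
      rcases (le_coeffMax a G p.2).lt_or_eq with h2 | h2
      · rw [h1]
        exact mul_lt_mul_of_pos_left h2 hF0
      · have hmem (H : MvPolynomial σ L) (hH : 0 < coeffMax a H) {γ : σ →₀ ℕ}
            (hγ : a (H.coeff γ) = coeffMax a H) :
            γ ∈ H.support.filter fun α => a (H.coeff α) = coeffMax a H := by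
          refine Finset.mem_filter.2 ⟨mem_support_iff.2 fun h => ?_, hγ⟩
          rw [h, map_zero] at hγ
          exact hH.ne hγ
        obtain ⟨e1, e2⟩ := huniq (hmem F hF0 h1) (hmem G hG0 h2)
          (Finset.HasAntidiagonal.mem_antidiagonal.1 hp)
        exact absurd (Prod.ext e1 e2) hpne
    rw [← hα.2, ← hβ.2, ← map_mul, ← h]
    exact le_coeffMax _ _ _

lemma abv_evalCoeffs_le {n N d m : ℕ} {a : AbsoluteValue L ℝ} (ha : IsNonarchimedean a)
    {I : MvPolynomial (ChowIndex n N d) L} (hI : I.IsHomogeneous m) {B : ℝ}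
    (hB : ∀ β, a (I.coeff β) ≤ B) (F : MvPolynomial (Fin (n + 1) × Fin (N + 1)) L) :
    a (evalCoeffs I F) ≤ B * coeffMax a F ^ m := by
  have hB0 : 0 ≤ B := (a.nonneg _).trans (hB 0)
  rw [evalCoeffs, eval_eq]
  refine (ha.apply_sum_le).trans
    (Real.iSup_le (fun β => ?_) (mul_nonneg hB0 (pow_nonneg (coeffMax_nonneg a F) _)))
  rw [map_mul, map_prod]
  refine mul_le_mul (hB _) ?_ (Finset.prod_nonneg fun _ _ => a.nonneg _) hB0
  have h := hI (mem_support_iff.1 β.2)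
  rw [Finsupp.weight_apply, Finsupp.sum] at h
  simp only [Pi.one_apply, smul_eq_mul, mul_one] at h
  rw [← h, ← Finset.prod_pow_eq_pow_sum]
  refine Finset.prod_le_prod (fun _ _ => a.nonneg _) fun γ _ => ?_
  rw [map_pow]
  exact pow_le_pow_left₀ (a.nonneg _) (le_coeffMax a F γ.1) _

/-- The coefficients of the translates of a semistable form cannot become small simultaneously,
because an invariant form in them is constant. -/
lemma le_mul_coeffMax_slAct_pow {k : Type*} [Field k] [IsAlgClosed k] {n N d m : ℕ}
    {a : AbsoluteValue L ℝ} (ha : IsNonarchimedean a) {I : MvPolynomial (ChowIndex n N d) k}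
    (hI : I.IsHomogeneous m) (hinv : IsInvariant I)
    {G : MvPolynomial (Fin (n + 1) × Fin (N + 1)) k}
    (hG : IsWeightedHomogeneous (multiWeight n N) G fun _ => d) (φ : k →+* L) {B : ℝ}
    (hB : ∀ β, a (φ (I.coeff β)) ≤ B) (g : Matrix.SpecialLinearGroup (Fin (N + 1)) L) :
    a (φ (evalCoeffs I G)) ≤ B * coeffMax a (slAct g (map φ G)) ^ m := by
  have h := congrArg a (evalCoeffs_rowSubst_pow hI hinv hG φ g)
  rw [map_pow, map_pow, pow_left_inj₀ (a.nonneg _) (a.nonneg _) N.succ_ne_zero] at h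
  rw [← h]
  exact abv_evalCoeffs_le ha (hI.map φ) (fun β => by rw [coeff_map]; exact hB β) _

end GaussNorm

/-! ### Finite places -/

section FinitePlaces

open IsDedekindDomain NumberField

variable {K : Type*} [Field K] [NumberField K] {n N : ℕ} {C : EffectiveCycle K n N}

/-- An embedding of a field in an algebraically closed field extends to the algebraic closure. -/
lemma exists_extension_algebraicClosure {K L : Type*} [Field K] [Field L] [IsAlgClosed L]
    (j : K →+* L) :
    ∃ φ : AlgebraicClosure K →+* L, φ.comp (algebraMap K (AlgebraicClosure K)) = j := by
  let := j.toAlgebra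
  exact ⟨(IsAlgClosed.lift : AlgebraicClosure K →ₐ[K] L).toRingHom,
    RingHom.ext fun x => (IsAlgClosed.lift : AlgebraicClosure K →ₐ[K] L).commutes x⟩

open scoped Valued in
lemma finAbs_mul (v : HeightOneSpectrum (𝓞 K)) (x y : FinAlgCl v) :
    finAbs v (x * y) = finAbs v x * finAbs v y :=
  let : NontriviallyNormedField (v.adicCompletion K) := Valued.toNontriviallyNormedField _ _
  spectralAlgNorm_mul x y

open scoped Valued in
lemma finAbs_add_le_max (v : HeightOneSpectrum (𝓞 K)) (x y : FinAlgCl v) :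
    finAbs v (x + y) ≤ max (finAbs v x) (finAbs v y) :=
  let : NontriviallyNormedField (v.adicCompletion K) := Valued.toNontriviallyNormedField _ _
  isNonarchimedean_spectralNorm x y

/-- The extension of the `v`-adic absolute value to the algebraic closure. -/
noncomputable def finAbv (v : HeightOneSpectrum (𝓞 K)) : AbsoluteValue (FinAlgCl v) ℝ where
  toFun := finAbs v
  map_mul' := finAbs_mul v
  nonneg' := spectralNorm_nonneg
  eq_zero' x := ⟨fun hx =>
      eq_zero_of_map_spectralNorm_eq_zero hx (Algebra.IsAlgebraic.isAlgebraic x),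
    fun h => by rw [h]; exact spectralNorm_zero⟩
  add_le' x y := (finAbs_add_le_max v x y).trans
    (max_le_add_of_nonneg (spectralNorm_nonneg x) (spectralNorm_nonneg y))

lemma isNonarchimedean_finAbv (v : HeightOneSpectrum (𝓞 K)) : IsNonarchimedean (finAbv v) :=
  finAbs_add_le_max v

lemma finAbv_finEmb (v : HeightOneSpectrum (𝓞 K)) (x : K) :
    finAbv v (finEmb v x) = FinitePlace.mk v x :=
  spectralNorm_extends _

lemma finite_finAbv_finEmb_ne_one {x : K} (hx : x ≠ 0) :
    {v : HeightOneSpectrum (𝓞 K) | finAbv v (finEmb v x) ≠ 1}.Finite := by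
  simp_rw [finAbv_finEmb]
  exact (FinitePlace.hasFiniteMulSupport hx).preimage
    (FinitePlace.equivHeightOneSpectrum (K := K)).symm.injective.injOn

/-- A root of a monic polynomial with coefficients of absolute value at most `1` has absolute value
at most `1`. -/
lemma abv_le_one_of_monic {k L : Type*} [Field k] [Field L] {a : AbsoluteValue L ℝ}
    (ha : IsNonarchimedean a) (j : k →+* L) {p : Polynomial k} (hp : p.Monic)
    (hc : ∀ i, a (j (p.coeff i)) ≤ 1) {x : L} (hx : p.eval₂ j x = 0) : a x ≤ 1 := by
  by_contra! h1
  have hx0 : x ^ p.natDegree = -∑ i ∈ Finset.range p.natDegree, j (p.coeff i) * x ^ i := by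
    rw [Polynomial.eval₂_eq_sum_range, Finset.sum_range_succ, hp.coeff_natDegree, map_one,
      one_mul] at hx
    exact (neg_eq_of_add_eq_zero_right hx).symm
  have hpos : p.natDegree ≠ 0 := fun h => by
    rw [h] at hx0
    simp at hx0
  have hle : a x ^ p.natDegree ≤ a x ^ (p.natDegree - 1) := by
    rw [← map_pow, hx0, a.map_neg]
    refine ha.apply_sum_le.trans (Real.iSup_le (fun i => ?_) (pow_nonneg (a.nonneg x) _))
    rw [map_mul, map_pow, ← one_mul (a x ^ (p.natDegree - 1))]
    refine mul_le_mul (hc _) (pow_le_pow_right₀ h1.le ?_) (pow_nonneg (a.nonneg x) _) zero_le_one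
    have := Finset.mem_range.1 i.2
    omega
  exact absurd hle (not_le.2 (pow_lt_pow_right₀ h1 (Nat.sub_lt (Nat.pos_of_ne_zero hpos) one_pos)))

/-- An algebraic number is integral at almost all finite places, for all embeddings. -/
lemma finite_one_lt_finAbv (x : AlgebraicClosure K) :
    {v : HeightOneSpectrum (𝓞 K) | ∃ φ : AlgebraicClosure K →+* FinAlgCl v,
      φ.comp (algebraMap K (AlgebraicClosure K)) = finEmb v ∧ 1 < finAbv v (φ x)}.Finite := by
  have hint : IsIntegral K x := Algebra.IsIntegral.isIntegral x
  have hfin : (⋃ i ∈ (minpoly K x).support, {v : HeightOneSpectrum (𝓞 K) |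
      finAbv v (finEmb v ((minpoly K x).coeff i)) ≠ 1}).Finite :=
    Set.Finite.biUnion (Finset.finite_toSet _) fun i hi =>
      finite_finAbv_finEmb_ne_one (Polynomial.mem_support_iff.1 hi)
  refine hfin.subset fun v ⟨φ, hφ, hv⟩ => ?_
  by_contra hnot
  simp only [Set.mem_iUnion, Set.mem_ofPred_eq, not_exists, not_not] at hnot
  refine hv.not_ge (abv_le_one_of_monic (isNonarchimedean_finAbv v) (finEmb v)
    (minpoly.monic hint) (fun i => ?_) ?_)
  · by_cases hi : i ∈ (minpoly K x).support
    · exact (hnot i hi).le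
    · rw [Polynomial.notMem_support_iff.1 hi, map_zero, map_zero]
      exact zero_le_one
  · rw [← hφ, ← Polynomial.hom_eval₂, ← Polynomial.aeval_def, minpoly.aeval, map_zero]

end FinitePlaces

end GITHeight

namespace GITHeight

open MvPolynomial Metric
open scoped ENNReal

/-! ### Logarithms of polynomials are integrable -/

section Plurisubharmonic

variable {V : Type*} [NormedAddCommGroup V] [NormedSpace ℂ V] [MeasurableSpace V] [BorelSpace V]
  (μ : Measure V) [μ.IsAddHaarMeasure]

lemma map_unit_smul_addHaar [ProperSpace V] {c : ℂ}
    (hc : ‖c‖ = 1) : μ.map (fun y => c • y) = μ := by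
  have hc0 : c ≠ 0 := norm_ne_zero_iff.1 (by rw [hc]; exact one_ne_zero)
  let e : V ≃L[ℂ] V := ContinuousLinearEquiv.smulLeft (Units.mk0 c hc0)
  have he : (fun y : V => c • y) = e := rfl
  have : (μ.map e).IsAddHaarMeasure :=
    AddEquiv.isAddHaarMeasure_map μ e.toLinearEquiv.toAddEquiv e.continuous e.symm.continuous
  have h := Measure.isAddLeftInvariant_eq_smul (μ.map e) μ
  have hball : μ.map e (ball 0 1) = μ (ball 0 1) := by
    rw [Measure.map_apply e.continuous.measurable measurableSet_ball]
    congr 1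
    ext y
    simp [← he, norm_smul, hc]
  have hk : (Measure.addHaarScalarFactor (μ.map e) μ : ℝ≥0∞) = 1 := by
    rw [h, Measure.smul_apply, ENNReal.smul_def, smul_eq_mul] at hball
    exact (ENNReal.mul_eq_right (measure_ball_pos μ 0 one_pos).ne' (measure_ball_lt_top).ne).1 hball
  rw [he, h]
  ext s _
  rw [Measure.smul_apply, ENNReal.smul_def, smul_eq_mul, hk, one_mul]

/-- The quantity `log A - log |z|`, which is nonnegative for `|z| ≤ A`. Its value at `z = 0` is `∞`,
so that a function with finite integral of `logDefect` vanishes almost nowhere. -/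
noncomputable def logDefect (A : ℝ) (z : ℂ) : ℝ≥0∞ :=
  if z = 0 then ∞ else ENNReal.ofReal (Real.log A - Real.log ‖z‖)

lemma measurable_logDefect (A : ℝ) : Measurable (logDefect A) :=
  Measurable.ite (measurableSet_singleton 0) measurable_const
    (measurable_const.sub (Real.measurable_log.comp measurable_norm)).ennreal_ofReal

lemma logDefect_anti (A : ℝ) {z w : ℂ} (h : ‖z‖ ≤ ‖w‖) : logDefect A w ≤ logDefect A z := by
  by_cases hz : z = 0
  · simp [logDefect, hz]
  have hz' : 0 < ‖z‖ := norm_pos_iff.2 hz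
  rw [logDefect, logDefect, if_neg hz, if_neg (norm_pos_iff.1 (hz'.trans_le h))]
  exact ENNReal.ofReal_le_ofReal (sub_le_sub_left (Real.log_le_log hz' h) _)

/-- A polynomial `p` with `p(0) = 1` and `|p| ≤ A` on the unit circle satisfies
`∫ (log A - log |p|) ≤ 2π log A`, by Jensen's formula. -/
lemma lintegral_circle_logDefect_le {A : ℝ} (hA : 1 ≤ A) {p : Polynomial ℂ} (h0 : p.eval 0 = 1)
    (hp : ∀ t : ℂ, ‖t‖ = 1 → ‖p.eval t‖ ≤ A) :
    ∫⁻ θ in Set.Ioc 0 (2 * Real.pi), logDefect A (p.eval (circleMap 0 1 θ)) ≤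
      ENNReal.ofReal (2 * Real.pi) * ENNReal.ofReal (Real.log A) := by
  have hp0 : p ≠ 0 := by
    rintro rfl
    simp at h0
  have hae : ∀ᵐ θ ∂(volume.restrict (Set.Ioc 0 (2 * Real.pi))),
      logDefect A (p.eval (circleMap 0 1 θ)) =
        ENNReal.ofReal (Real.log A - Real.log ‖p.eval (circleMap 0 1 θ)‖) := by
    have hcount : (circleMap 0 1 ⁻¹' {t | p.IsRoot t}).Countable :=
      (Polynomial.finite_setOfPred_isRoot hp0).countable.preimage_circleMap 0 one_ne_zero
    filter_upwards [ae_restrict_of_ae (hcount.ae_notMem volume)] with θ hθ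
    exact if_neg hθ
  rw [lintegral_congr_ae hae]
  have hint : IntegrableOn (fun θ => Real.log ‖p.eval (circleMap 0 1 θ)‖)
      (Set.Ioc 0 (2 * Real.pi)) :=
    (intervalIntegrable_iff_integrableOn_Ioc_of_le Real.two_pi_pos.le).1
      p.intervalIntegrable_mahlerMeasure
  have hconst : IntegrableOn (fun _ : ℝ => Real.log A) (Set.Ioc 0 (2 * Real.pi)) :=
    integrableOn_const (by rw [Real.volume_Ioc]; exact ENNReal.ofReal_ne_top)
  have hnonneg (θ : ℝ) : 0 ≤ Real.log A - Real.log ‖p.eval (circleMap 0 1 θ)‖ := by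
    -- at a zero of `p` the logarithm has the value `0`, and `log A` is nonnegative
    rw [sub_nonneg]
    rcases (norm_nonneg (p.eval (circleMap 0 1 θ))).eq_or_lt with h | h
    · rw [← h, Real.log_zero]
      exact Real.log_nonneg hA
    · exact Real.log_le_log h (hp _ (by simp))
  rw [← ofReal_integral_eq_lintegral_ofReal (f := fun θ => Real.log A -
    Real.log ‖p.eval (circleMap 0 1 θ)‖) (hconst.sub hint) (ae_of_all _ hnonneg),
    ← ENNReal.ofReal_mul Real.two_pi_pos.le]
  refine ENNReal.ofReal_le_ofReal ?_
  rw [integral_sub hconst hint, setIntegral_const, sub_le_iff_le_add]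
  have h1 : 0 ≤ p.logMahlerMeasure := by
    rw [Polynomial.logMahlerMeasure_eq_log_MahlerMeasure]
    refine Real.log_nonneg ?_
    have := p.norm_coeff_le_choose_mul_mahlerMeasure 0
    rwa [Polynomial.coeff_zero_eq_eval_zero, h0, norm_one, Nat.choose_zero_right, Nat.cast_one,
      one_mul] at this
  rw [Polynomial.logMahlerMeasure_def, Real.circleAverage_def,
    intervalIntegral.integral_of_le Real.two_pi_pos.le, smul_eq_mul] at h1
  have h2 := nonneg_of_mul_nonneg_right h1 (inv_pos.2 Real.two_pi_pos)
  simp only [Measure.real, Real.volume_Ioc, sub_zero, ENNReal.toReal_ofReal Real.two_pi_pos.le,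
    smul_eq_mul]
  linarith

/-- The mean value inequality for `log |f|` on a ball around a point `x₀` with `f(x₀) = 1`, for a
function `f` that is polynomial on complex lines: average over the rotations `x₀ + e^{iθ} z` of the
ball and use Jensen's formula on each circle. -/
lemma lintegral_ball_logDefect_le [ProperSpace V]
    {f : V → ℂ} (hf : Continuous f)
    (hpoly : ∀ x y : V, ∃ p : Polynomial ℂ, ∀ t : ℂ, f (x + t • y) = p.eval t)
    {x₀ : V} (h0 : f x₀ = 1) {R A : ℝ} (hA : 1 ≤ A) (hfA : ∀ y ∈ ball x₀ R, ‖f y‖ ≤ A) :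
    ∫⁻ y in ball x₀ R, logDefect A (f y) ∂μ ≤
      μ (ball x₀ R) * ENNReal.ofReal (Real.log A) := by
  set h : V → ℝ≥0∞ := fun y => logDefect A (f y) with hh
  have hmeas : Measurable h :=
    (measurable_logDefect A).comp hf.measurable
  have hrot (θ : ℝ) : ∫⁻ y in ball x₀ R, h y ∂μ =
      ∫⁻ z in ball 0 R, h (x₀ + circleMap 0 1 θ • z) ∂μ := by
    have hc : ‖circleMap 0 1 θ‖ = 1 := by simp
    have hmp : MeasurePreserving (fun z => x₀ + circleMap 0 1 θ • z) μ μ :=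
      (measurePreserving_add_left μ x₀).comp
        ⟨measurable_const_smul _, map_unit_smul_addHaar μ hc⟩
    rw [← hmp.setLIntegral_comp_preimage measurableSet_ball hmeas]
    congr 2
    ext z
    simp [norm_smul, hc]
  have hcirc : Measurable fun q : ℝ × V => h (x₀ + circleMap 0 1 q.1 • q.2) := by
    refine hmeas.comp (Continuous.measurable ?_)
    fun_prop
  have hvol : volume (Set.Ioc 0 (2 * Real.pi)) = ENNReal.ofReal (2 * Real.pi) := by simp
  have hpi0 : ENNReal.ofReal (2 * Real.pi) ≠ 0 := by simp [Real.pi_pos]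
  rw [← ENNReal.mul_le_mul_iff_right hpi0 ENNReal.ofReal_ne_top]
  calc ENNReal.ofReal (2 * Real.pi) * ∫⁻ y in ball x₀ R, h y ∂μ
      = ∫⁻ θ in Set.Ioc 0 (2 * Real.pi), ∫⁻ z in ball 0 R, h (x₀ + circleMap 0 1 θ • z) ∂μ := by
        rw [← hvol, mul_comm, ← setLIntegral_const]
        exact lintegral_congr hrot
    _ = ∫⁻ z in ball 0 R, ∫⁻ θ in Set.Ioc 0 (2 * Real.pi), h (x₀ + circleMap 0 1 θ • z)
          ∂volume ∂μ :=
        lintegral_lintegral_swap hcirc.aemeasurable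
    _ ≤ ∫⁻ z in ball (0 : V) R,
          ENNReal.ofReal (2 * Real.pi) * ENNReal.ofReal (Real.log A) ∂μ := by
        refine setLIntegral_mono measurable_const fun z hz => ?_
        obtain ⟨p, hp⟩ := hpoly x₀ z
        simp only [hh, hp]
        refine lintegral_circle_logDefect_le hA ?_ fun t ht => ?_
        · rw [← hp, zero_smul, add_zero, h0]
        · rw [← hp]
          refine hfA _ ?_
          simpa [norm_smul, ht] using hz
    _ = ENNReal.ofReal (2 * Real.pi) * (μ (ball x₀ R) * ENNReal.ofReal (Real.log A)) := by
        rw [setLIntegral_const, Measure.addHaar_ball_center μ x₀ R]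
        ring

end Plurisubharmonic

/-! ### The unit sphere as a quotient of the unit ball -/

section Sphere

variable (N : ℕ)

/-- The sphere measure is the image, under radial projection, of a Haar measure on the punctured
unit ball. -/
lemma exists_map_eq_sphereMeasure :
    ∃ (κ : ℝ≥0∞) (D : Set (Fin (N + 1) → ℂ))
      (ν : (Fin (N + 1) → ℂ) → sphere (0 : EuclideanSpace ℂ (Fin (N + 1))) 1),
      κ ≠ 0 ∧ κ ≠ ∞ ∧ MeasurableSet D ∧ Measurable ν ∧
      (∀ y ∈ D, ∃ r : ℝ, 0 < r ∧ r < 1 ∧ ∀ j, y j = r * (ν y).1 j) ∧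
      sphereMeasure N = Measure.map ν ((κ • (volume : Measure (Fin (N + 1) → ℂ))).restrict D) := by
  let E := EuclideanSpace ℂ (Fin (N + 1))
  let toE : (Fin (N + 1) → ℂ) ≃L[ℂ] E := (PiLp.continuousLinearEquiv 2 ℂ _).symm
  let μ : Measure E := (volume : Measure (Fin (N + 1) → ℂ)).map toE
  have hμ : μ.IsAddHaarMeasure :=
    AddEquiv.isAddHaarMeasure_map volume toE.toLinearEquiv.toAddEquiv toE.continuous
      toE.symm.continuous
  let e : E := EuclideanSpace.single 0 1
  let ρ : E → sphere (0 : E) 1 := fun y =>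
    ⟨if y = 0 then e else ((‖y‖⁻¹ : ℝ) : ℂ) • y, by
      split_ifs with h
      · rw [mem_sphere_zero_iff_norm, PiLp.norm_single, norm_one]
      · rw [mem_sphere_zero_iff_norm, norm_smul, Complex.norm_real, norm_inv, norm_norm,
          inv_mul_cancel₀ (norm_ne_zero_iff.2 h)]⟩
  have hρ : Measurable ρ := by
    refine Measurable.subtype_mk (Measurable.ite (measurableSet_singleton 0) measurable_const ?_)
    exact (Complex.measurable_ofReal.comp measurable_norm.inv).smul measurable_id
  let B : Set E := ball 0 1 \ {0}
  have hB : MeasurableSet B := measurableSet_ball.diff (measurableSet_singleton 0)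
  have hsph : μ.toSphere = (Module.finrank ℝ E : ℝ≥0∞) • (μ.restrict B).map ρ := by
    ext s hs
    rw [Measure.toSphere_apply' μ hs, Measure.smul_apply, Measure.map_apply hρ hs,
      Measure.restrict_apply (hρ hs), smul_eq_mul]
    congr 2
    ext y
    constructor
    · rintro ⟨r, hr, _, ⟨ω, hω, rfl⟩, rfl⟩
      have hω1 : ‖(ω : E)‖ = 1 := norm_eq_of_mem_sphere ω
      have hnorm : ‖r • (ω : E)‖ = r := by rw [norm_smul, hω1, mul_one, Real.norm_of_nonneg hr.1.le]
      have hne : r • (ω : E) ≠ 0 := norm_ne_zero_iff.1 (by rw [hnorm]; exact hr.1.ne')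
      refine ⟨?_, ?_, hne⟩
      · have : ρ (r • (ω : E)) = ω := by
          refine Subtype.ext ?_
          simp only [ρ]
          rw [if_neg hne, hnorm, Complex.coe_smul, smul_smul, inv_mul_cancel₀ hr.1.ne', one_smul]
        simpa [this] using hω
      · simpa [hnorm] using hr.2
    · rintro ⟨hy, hy1, hy0⟩
      have hy0' : y ≠ 0 := hy0
      have hn : 0 < ‖y‖ := norm_pos_iff.2 hy0'
      refine ⟨‖y‖, ⟨hn, by simpa using hy1⟩, ρ y, ⟨ρ y, hy, rfl⟩, ?_⟩
      simp only [ρ]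
      rw [if_neg hy0', Complex.coe_smul, smul_smul, mul_inv_cancel₀ hn.ne', one_smul]
  have hdim : (Module.finrank ℝ E : ℝ≥0∞) ≠ 0 := by
    rw [Nat.cast_ne_zero]
    exact (Module.finrank_pos (R := ℝ) (M := E)).ne'
  have hσ0 : μ.toSphere Set.univ ≠ 0 := by
    rw [Measure.measure_univ_ne_zero]
    exact Measure.toSphere_ne_zero μ
  have hσt : μ.toSphere Set.univ ≠ ∞ := measure_ne_top _ _
  have hcoe (y : Fin (N + 1) → ℂ) (j) : toE y j = y j := rfl
  refine ⟨(μ.toSphere Set.univ)⁻¹ * Module.finrank ℝ E, toE ⁻¹' B, ρ ∘ toE,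
    mul_ne_zero (ENNReal.inv_ne_zero.2 hσt) hdim,
    ENNReal.mul_ne_top (ENNReal.inv_ne_top.2 hσ0) (ENNReal.natCast_ne_top _),
    toE.continuous.measurable hB, hρ.comp toE.continuous.measurable, ?_, ?_⟩
  · rintro y ⟨hy1, hy0⟩
    have hy0' : toE y ≠ 0 := hy0
    have hn : 0 < ‖toE y‖ := norm_pos_iff.2 hy0'
    refine ⟨‖toE y‖, hn, by simpa using hy1, fun j => ?_⟩
    simp only [ρ, Function.comp_apply]
    rw [if_neg hy0', PiLp.smul_apply, smul_eq_mul, ← mul_assoc, ← Complex.ofReal_mul,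
      mul_inv_cancel₀ hn.ne', Complex.ofReal_one, one_mul, hcoe]
  · change (μ.toSphere Set.univ)⁻¹ • μ.toSphere = _
    rw [Measure.restrict_smul, Measure.map_smul, mul_smul,
      ← Measure.map_map hρ toE.continuous.measurable,
      ← Measure.restrict_map toE.continuous.measurable hB]
    exact congrArg _ hsph

instance : IsProbabilityMeasure (sphereMeasure N) := by
  let toE : (Fin (N + 1) → ℂ) ≃L[ℂ] EuclideanSpace ℂ (Fin (N + 1)) :=
    (PiLp.continuousLinearEquiv 2 ℂ _).symm
  let μ : Measure (EuclideanSpace ℂ (Fin (N + 1))) :=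
    (volume : Measure (Fin (N + 1) → ℂ)).map toE
  have hμ : μ.IsAddHaarMeasure :=
    AddEquiv.isAddHaarMeasure_map volume toE.toLinearEquiv.toAddEquiv toE.continuous
      toE.symm.continuous
  have hσ0 : μ.toSphere Set.univ ≠ 0 := by
    rw [Measure.measure_univ_ne_zero]
    exact Measure.toSphere_ne_zero μ
  refine ⟨?_⟩
  change ((μ.toSphere Set.univ)⁻¹ • μ.toSphere) Set.univ = 1
  exact ENNReal.inv_mul_cancel hσ0 (measure_ne_top _ _)

end Sphere

end GITHeight

namespace GITHeight

open MvPolynomial Metric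
open scoped ENNReal

/-! ### Forms on the product of spheres -/

section Forms

variable {n N d : ℕ}

/-- The function on `(ℂ^{N+1})^{n+1}` defined by a polynomial in the `u_{ij}`. The arguments are
nested tuples, with the supremum norm; the unit ball is the unit polydisc. -/
noncomputable def rowEval (F : MvPolynomial (Fin (n + 1) × Fin (N + 1)) ℂ)
    (x : Fin (n + 1) → Fin (N + 1) → ℂ) : ℂ :=
  eval (fun ij : Fin (n + 1) × Fin (N + 1) => x ij.1 ij.2) F

lemma continuous_rowEval (F : MvPolynomial (Fin (n + 1) × Fin (N + 1)) ℂ) :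
    Continuous (rowEval F) :=
  (MvPolynomial.continuous_eval F).comp (by fun_prop)

lemma exists_polynomial_rowEval (F : MvPolynomial (Fin (n + 1) × Fin (N + 1)) ℂ)
    (x y : Fin (n + 1) → Fin (N + 1) → ℂ) :
    ∃ p : Polynomial ℂ, ∀ t : ℂ, rowEval F (x + t • y) = p.eval t := by
  refine ⟨eval₂ Polynomial.C (fun ij : Fin (n + 1) × Fin (N + 1) =>
    Polynomial.C (x ij.1 ij.2) + Polynomial.X * Polynomial.C (y ij.1 ij.2)) F, fun t => ?_⟩
  have hid : (Polynomial.evalRingHom t).comp Polynomial.C = RingHom.id ℂ := by ext; simp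
  rw [← Polynomial.coe_evalRingHom, hom_eval₂, hid, eval₂_id]
  simp only [Polynomial.coe_evalRingHom, Polynomial.eval_add, Polynomial.eval_mul,
    Polynomial.eval_X, Polynomial.eval_C]
  rfl

lemma rowEval_scale {F : MvPolynomial (Fin (n + 1) × Fin (N + 1)) ℂ}
    (hF : IsWeightedHomogeneous (multiWeight n N) F fun _ => d) (r : Fin (n + 1) → ℂ)
    (x : Fin (n + 1) → Fin (N + 1) → ℂ) :
    rowEval F (fun i j => r i * x i j) = (∏ i, r i) ^ d * rowEval F x := by
  have h := aeval_scale_rows hF r fun ij => x ij.1 ij.2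
  simpa [aeval_def, rowEval] using h

lemma rowEval_smul {F : MvPolynomial (Fin (n + 1) × Fin (N + 1)) ℂ}
    (hF : IsWeightedHomogeneous (multiWeight n N) F fun _ => d) (c : ℂ)
    (x : Fin (n + 1) → Fin (N + 1) → ℂ) :
    rowEval F (c • x) = c ^ ((n + 1) * d) * rowEval F x := by
  have h := rowEval_scale hF (fun _ => c) x
  rwa [Finset.prod_const, Finset.card_univ, Fintype.card_fin, ← pow_mul] at h

/-- A bound for a form on the unit polydisc gives a bound on all of space. -/
lemma norm_rowEval_le {F : MvPolynomial (Fin (n + 1) × Fin (N + 1)) ℂ}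
    (hF : IsWeightedHomogeneous (multiWeight n N) F fun _ => d) {M : ℝ}
    (hM : ∀ x ∈ closedBall (0 : Fin (n + 1) → Fin (N + 1) → ℂ) 1, ‖rowEval F x‖ ≤ M)
    {ρ : ℝ} (hρ : 0 < ρ) {y : Fin (n + 1) → Fin (N + 1) → ℂ} (hy : ‖y‖ ≤ ρ) :
    ‖rowEval F y‖ ≤ ρ ^ ((n + 1) * d) * M := by
  have hρ' : (ρ : ℂ) ≠ 0 := Complex.ofReal_ne_zero.2 hρ.ne'
  have h := rowEval_smul hF (ρ : ℂ) ((ρ : ℂ)⁻¹ • y)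
  rw [smul_smul, mul_inv_cancel₀ hρ', one_smul] at h
  rw [h, norm_mul, norm_pow, Complex.norm_real, Real.norm_of_nonneg hρ.le]
  refine mul_le_mul_of_nonneg_left (hM _ ?_) (by positivity)
  rw [mem_closedBall_zero_iff, norm_smul, norm_inv, Complex.norm_real, Real.norm_of_nonneg hρ.le]
  exact inv_mul_le_one_of_le₀ hy hρ.le

lemma exists_rowEval_ne_zero {F : MvPolynomial (Fin (n + 1) × Fin (N + 1)) ℂ} (hF : F ≠ 0) :
    ∃ x, rowEval F x ≠ 0 := by
  by_contra! h
  exact hF (MvPolynomial.funext fun u => by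
    rw [map_zero]
    exact h fun i j => u (i, j))

/-- `log |F|` is integrable over the product of spheres for a nonzero form `F`, and its integral is
bounded below by the logarithm of the maximum of `|F|` on the unit polydisc, up to a constant that
depends only on the multidegree. With `x₀` a point where the maximum is attained, this is the mean
value inequality on a polydisc around `x₀` that contains the unit polydisc. -/
lemma exists_log_sub_le_integral_logAbs (n N d : ℕ) :
    ∃ κ : ℝ, ∀ F : MvPolynomial (Fin (n + 1) × Fin (N + 1)) ℂ,
      IsWeightedHomogeneous (multiWeight n N) F (fun _ => d) → F ≠ 0 →
      ∃ M : ℝ, 0 < M ∧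
        (∀ x ∈ closedBall (0 : Fin (n + 1) → Fin (N + 1) → ℂ) 1, ‖rowEval F x‖ ≤ M) ∧
        (∀ᵐ x ∂(Measure.pi fun _ : Fin (n + 1) => sphereMeasure N),
          rowEval F (fun i j => (x i).1 j) ≠ 0) ∧
        Integrable (logAbs F) (Measure.pi fun _ : Fin (n + 1) => sphereMeasure N) ∧
        Real.log M - κ ≤ ∫ x, logAbs F x ∂(Measure.pi fun _ : Fin (n + 1) => sphereMeasure N) := by
  obtain ⟨c, D, ν, hc0, hct, hD, hν, hDν, hσ⟩ := exists_map_eq_sphereMeasure N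
  have : (c • (volume : Measure (Fin (N + 1) → ℂ))).IsAddHaarMeasure :=
    Measure.IsAddHaarMeasure.smul _ hc0 hct
  let P : Measure (Fin (n + 1) → Fin (N + 1) → ℂ) :=
    Measure.pi fun _ => c • (volume : Measure (Fin (N + 1) → ℂ))
  set S : Measure (Fin (n + 1) → sphere (0 : EuclideanSpace ℂ (Fin (N + 1))) 1) :=
    Measure.pi fun _ => sphereMeasure N with hS
  -- a form bounded by `1` on the unit polydisc is bounded by `A` on the polydisc of radius `4`,
  -- which contains the one of radius `3` around each point `x₀` of the unit polydisc
  let A : ℝ := 4 ^ ((n + 1) * d)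
  have hA : 1 ≤ A := one_le_pow₀ (by norm_num)
  refine ⟨(P (ball 0 3)).toReal * Real.log A, fun F hF hF0 => ?_⟩
  obtain ⟨x₀, hx₀, hmax⟩ := (isCompact_closedBall (0 : Fin (n + 1) → Fin (N + 1) → ℂ) 1)
    |>.exists_isMaxOn ⟨0, by simp⟩ (continuous_rowEval F).norm.continuousOn
  have hmax' : ∀ x ∈ closedBall (0 : Fin (n + 1) → Fin (N + 1) → ℂ) 1,
      ‖rowEval F x‖ ≤ ‖rowEval F x₀‖ := fun x hx => hmax hx
  have hM : 0 < ‖rowEval F x₀‖ := by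
    obtain ⟨y, hy⟩ := exists_rowEval_ne_zero hF0
    have h := norm_rowEval_le hF hmax' (ρ := ‖y‖ + 1) (by positivity) (by linarith)
    exact pos_of_mul_pos_right ((norm_pos_iff.2 hy).trans_le h) (by positivity)
  have hw : rowEval F x₀ ≠ 0 := norm_pos_iff.1 hM
  -- the mean value inequality, transported to the product of spheres by radial projection
  have hball := lintegral_ball_logDefect_le P (f := fun y => rowEval F y / rowEval F x₀)
    ((continuous_rowEval F).div_const _)
    (fun x y => by
      obtain ⟨p, hp⟩ := exists_polynomial_rowEval F x y
      refine ⟨Polynomial.C (rowEval F x₀)⁻¹ * p, fun t => ?_⟩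
      rw [hp, Polynomial.eval_mul, Polynomial.eval_C, div_eq_inv_mul])
    (div_self hw) (R := 3) hA (fun y hy => by
      rw [norm_div, div_le_iff₀ hM]
      refine norm_rowEval_le hF hmax' (by norm_num) ?_
      have h1 : ‖x₀‖ ≤ 1 := by simpa using hx₀
      have h2 : ‖y - x₀‖ < 3 := by simpa [dist_eq_norm] using hy
      linarith [norm_le_norm_add_norm_sub' y x₀])
  have hmeasF : Measurable fun x : Fin (n + 1) → sphere (0 : EuclideanSpace ℂ (Fin (N + 1))) 1 =>
      rowEval F (fun i j => (x i).1 j) := by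
    refine ((continuous_rowEval F).comp ?_).measurable
    fun_prop
  have hsphere : ∫⁻ x, logDefect A (rowEval F (fun i j => (x i).1 j) / rowEval F x₀) ∂S ≤
      P (ball 0 3) * ENNReal.ofReal (Real.log A) := by
    have hSmap : S = Measure.map (fun x i => ν (x i))
        (P.restrict (Set.univ.pi fun _ => D)) := by
      have hsf (i : Fin (n + 1)) : SigmaFinite (Measure.map ν
          ((c • (volume : Measure (Fin (N + 1) → ℂ))).restrict D)) := by
        rw [← hσ]; infer_instance
      have hpi := Measure.pi_map_pi
        (μ := fun _ : Fin (n + 1) => (c • (volume : Measure (Fin (N + 1) → ℂ))).restrict D)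
        (f := fun _ => ν) (hμ := hsf) fun _ => hν.aemeasurable
      rw [hS, Measure.restrict_pi_pi, hpi, hσ]
    have hνm : Measurable fun (x : Fin (n + 1) → Fin (N + 1) → ℂ) i => ν (x i) :=
      measurable_pi_lambda _ fun i => hν.comp (measurable_pi_apply i)
    rw [hSmap, lintegral_map (f := fun x : Fin (n + 1) → sphere (0 : EuclideanSpace ℂ
      (Fin (N + 1))) 1 => logDefect A (rowEval F (fun i j => (x i).1 j) / rowEval F x₀))
      ((measurable_logDefect A).comp (hmeasF.div_const _)) hνm]
    rw [← Measure.addHaar_ball_center P x₀ 3]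
    refine le_trans ?_ hball
    refine le_trans (lintegral_mono_ae ?_) (lintegral_mono_set (s := Set.univ.pi fun _ => D) ?_)
    · filter_upwards [ae_restrict_mem (MeasurableSet.univ_pi fun _ => hD)] with y hy
      refine logDefect_anti A ?_
      choose r hr0 hr1 hr using fun i => hDν (y i) (hy i trivial)
      have hy' : y = fun i j => (r i : ℂ) * (ν (y i)).1 j := by
        funext i j
        exact hr i j
      rw [norm_div, norm_div]
      refine div_le_div_of_nonneg_right ?_ hM.le
      conv_lhs => rw [hy', rowEval_scale hF]
      rw [norm_mul, norm_pow, norm_prod]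
      refine mul_le_of_le_one_left (norm_nonneg _) (pow_le_one₀ (by positivity) ?_)
      refine Finset.prod_le_one (fun _ _ => norm_nonneg _) fun i _ => ?_
      rw [Complex.norm_real, Real.norm_of_nonneg (hr0 i).le]
      exact (hr1 i).le
    · intro y hy
      have hy1 : ‖y‖ ≤ 1 := by
        refine (pi_norm_le_iff_of_nonneg zero_le_one).2 fun i =>
          (pi_norm_le_iff_of_nonneg zero_le_one).2 fun j => ?_
        obtain ⟨r, hr0, hr1, hr⟩ := hDν (y i) (hy i trivial)
        rw [hr, norm_mul, Complex.norm_real, Real.norm_of_nonneg hr0.le]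
        refine mul_le_one₀ hr1.le (norm_nonneg _) ?_
        exact (PiLp.norm_apply_le _ j).trans (norm_eq_of_mem_sphere (ν (y i))).le
      have h1 : ‖x₀‖ ≤ 1 := by simpa using hx₀
      rw [mem_ball_iff_norm]
      linarith [norm_sub_le y x₀]
  have hPtop : P (ball 0 3) ≠ ∞ := measure_ball_lt_top.ne
  have hbdd : P (ball 0 3) * ENNReal.ofReal (Real.log A) ≠ ∞ :=
    ENNReal.mul_ne_top hPtop ENNReal.ofReal_ne_top
  have hmeasdef : Measurable fun x : Fin (n + 1) →
      sphere (0 : EuclideanSpace ℂ (Fin (N + 1))) 1 =>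
        logDefect A (rowEval F (fun i j => (x i).1 j) / rowEval F x₀) :=
    (measurable_logDefect A).comp (hmeasF.div_const _)
  have hne : ∀ᵐ x ∂S, rowEval F (fun i j => (x i).1 j) ≠ 0 := by
    filter_upwards [ae_lt_top hmeasdef (hsphere.trans_lt hbdd.lt_top).ne] with x hx h0
    simp [logDefect, h0] at hx
  let G : (Fin (n + 1) → sphere (0 : EuclideanSpace ℂ (Fin (N + 1))) 1) → ℝ := fun x =>
    Real.log A - Real.log ‖rowEval F (fun i j => (x i).1 j) / rowEval F x₀‖
  have hGmeas : Measurable G :=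
    measurable_const.sub (Real.measurable_log.comp (hmeasF.div_const _).norm)
  have hG0 : 0 ≤ᵐ[S] G := by
    filter_upwards [hne] with x hx
    refine sub_nonneg.2 (Real.log_le_log (norm_pos_iff.2 (div_ne_zero hx hw)) ?_)
    rw [norm_div, div_le_iff₀ hM]
    refine (hmax' _ ?_).trans (le_mul_of_one_le_left hM.le hA)
    rw [mem_closedBall_zero_iff]
    refine (pi_norm_le_iff_of_nonneg zero_le_one).2 fun i =>
      (pi_norm_le_iff_of_nonneg zero_le_one).2 fun j => ?_
    exact (PiLp.norm_apply_le _ j).trans (norm_eq_of_mem_sphere (x i)).le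
  have hGlint : ∫⁻ x, ENNReal.ofReal (G x) ∂S ≤ P (ball 0 3) * ENNReal.ofReal (Real.log A) := by
    refine le_trans (lintegral_mono_ae ?_) hsphere
    filter_upwards [hne] with x hx
    rw [logDefect, if_neg (div_ne_zero hx hw)]
  have hGint : Integrable G S :=
    (lintegral_ofReal_ne_top_iff_integrable hGmeas.aestronglyMeasurable hG0).1
      (hGlint.trans_lt hbdd.lt_top).ne
  have hGle : ∫ x, G x ∂S ≤ (P (ball 0 3)).toReal * Real.log A := by
    rw [integral_eq_lintegral_of_nonneg_ae hG0 hGmeas.aestronglyMeasurable]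
    refine (ENNReal.toReal_mono hbdd hGlint).trans ?_
    rw [ENNReal.toReal_mul, ENNReal.toReal_ofReal (Real.log_nonneg hA)]
  have hlog : logAbs F =ᵐ[S] fun x => (Real.log ‖rowEval F x₀‖ + Real.log A) - G x := by
    filter_upwards [hne] with x hx
    simp only [G]
    rw [norm_div, Real.log_div (norm_ne_zero_iff.2 hx) hM.ne']
    change Real.log ‖rowEval F (fun i j => (x i).1 j)‖ = _
    ring
  refine ⟨_, hM, hmax', hne, ((integrable_const _).sub hGint).congr hlog.symm, ?_⟩
  rw [integral_congr_ae hlog, integral_sub (integrable_const _) hGint, integral_const,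
    probReal_univ, one_smul]
  linarith [Real.log_nonneg hA]

/-- Cauchy's inequality up to a constant: the coefficients of a form of given degree are bounded by
its maximum on the unit polydisc, since linear functionals on a finite-dimensional normed space are
bounded. -/
lemma exists_norm_coeff_le (n N d : ℕ) (α : Fin (n + 1) × Fin (N + 1) →₀ ℕ) :
    ∃ B : ℝ, 0 ≤ B ∧ ∀ F : MvPolynomial (Fin (n + 1) × Fin (N + 1)) ℂ,
      IsWeightedHomogeneous (multiWeight n N) F (fun _ => d) → ∀ M : ℝ, 0 ≤ M →
      (∀ x ∈ closedBall (0 : Fin (n + 1) → Fin (N + 1) → ℂ) 1, ‖rowEval F x‖ ≤ M) →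
      ‖F.coeff α‖ ≤ B * M := by
  let W := weightedHomogeneousSubmodule ℂ (multiWeight n N) fun _ => d
  have hWle : W ≤ weightedHomogeneousSubmodule ℂ (fun _ => 1) ((n + 1) * d) := by
    intro F hF β hβ
    have hw : ∀ i, ∑ j, β (i, j) = d := fun i => by rw [← weight_multiWeight_apply, hF hβ]
    rw [Finsupp.weight_apply, Finsupp.sum_fintype _ _ (by simp), Fintype.sum_prod_type]
    simp [hw]
  have hfin : Module.Finite ℂ (weightedHomogeneousSubmodule ℂ
      (fun _ : Fin (n + 1) × Fin (N + 1) => 1) ((n + 1) * d)) :=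
    Module.Finite.iff_fg.2 (weightedHomogeneousSubmodule_fg ℂ _ (fun _ => one_ne_zero) _)
  have hWfin : Module.Finite ℂ W := Submodule.finiteDimensional_of_le hWle
  let X := closedBall (0 : Fin (n + 1) → Fin (N + 1) → ℂ) 1
  have hX : CompactSpace X := isCompact_iff_compactSpace.1 (isCompact_closedBall _ _)
  let ι : W →ₗ[ℂ] C(X, ℂ) :=
    { toFun := fun F => ⟨fun x => rowEval F.1 x.1,
        (continuous_rowEval _).comp continuous_subtype_val⟩
      map_add' := fun F G => by ext x; simp [rowEval]
      map_smul' := fun c F => by ext x; simp [rowEval, smul_eval] }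
  have hι : Function.Injective ι := by
    refine (injective_iff_map_eq_zero ι).2 fun F hF => ?_
    by_contra hne
    obtain ⟨y, hy⟩ := exists_rowEval_ne_zero fun h => hne (Subtype.ext h)
    have h0 : ∀ x ∈ X, ‖rowEval F.1 x‖ ≤ 0 := fun x hx =>
      (norm_le_zero_iff.2 (DFunLike.congr_fun hF (⟨x, hx⟩ : X)))
    have h := norm_rowEval_le F.2 h0 (ρ := ‖y‖ + 1) (by positivity) (by linarith)
    rw [mul_zero] at h
    exact hy (norm_le_zero_iff.1 h)
  let e : W ≃ₗ[ℂ] LinearMap.range ι := LinearEquiv.ofInjective ι hι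
  let ψ : LinearMap.range ι →L[ℂ] ℂ :=
    LinearMap.toContinuousLinearMap (((lcoeff ℂ α).comp W.subtype).comp e.symm.toLinearMap)
  refine ⟨‖ψ‖, ψ.opNorm_nonneg, fun F hF M hM0 hM => ?_⟩
  have h1 : ψ (e ⟨F, hF⟩) = F.coeff α := by simp [ψ]
  rw [← h1]
  refine (ψ.le_opNorm _).trans (mul_le_mul_of_nonneg_left ?_ ψ.opNorm_nonneg)
  exact (ContinuousMap.norm_le _ hM0).2 fun x => hM x.1 x.2

lemma exists_norm_evalCoeffs_le {m : ℕ} {I : MvPolynomial (ChowIndex n N d) ℂ}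
    (hI : I.IsHomogeneous m) :
    ∃ B : ℝ, ∀ F : MvPolynomial (Fin (n + 1) × Fin (N + 1)) ℂ,
      IsWeightedHomogeneous (multiWeight n N) F (fun _ => d) → ∀ M : ℝ, 0 ≤ M →
      (∀ x ∈ closedBall (0 : Fin (n + 1) → Fin (N + 1) → ℂ) 1, ‖rowEval F x‖ ≤ M) →
      ‖evalCoeffs I F‖ ≤ B * M ^ m := by
  choose B hB0 hB using exists_norm_coeff_le n N d
  refine ⟨∑ β ∈ I.support, ‖I.coeff β‖ * ∏ α ∈ β.support, B α.1 ^ β α, fun F hF M hM0 hM => ?_⟩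
  rw [evalCoeffs, eval_eq, Finset.sum_mul]
  refine norm_sum_le_of_le _ fun β hβ => ?_
  have h := hI (mem_support_iff.1 hβ)
  rw [Finsupp.weight_apply, Finsupp.sum] at h
  simp only [Pi.one_apply, smul_eq_mul, mul_one] at h
  rw [norm_mul, norm_prod, mul_assoc, ← h, ← Finset.prod_pow_eq_pow_sum, ← Finset.prod_mul_distrib]
  refine mul_le_mul_of_nonneg_left (Finset.prod_le_prod (fun _ _ => norm_nonneg _) fun α _ => ?_)
    (norm_nonneg _)
  rw [norm_pow, ← mul_pow]
  exact pow_le_pow_left₀ (norm_nonneg _) (hB _ F hF M hM0 hM) _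

end Forms

end GITHeight

namespace GITHeight

open MvPolynomial IsDedekindDomain NumberField

/-! ### Bounds on orbits of semistable cycles -/

section Orbits

variable {K : Type*} [Field K] {n N : ℕ}

lemma isWeightedHomogeneous_map {R S : Type*} [CommRing R] [CommRing S] {σ M : Type*}
    [AddCommMonoid M] {w : σ → M} {e : M} (f : R →+* S) {F : MvPolynomial σ R}
    (hF : IsWeightedHomogeneous w F e) : IsWeightedHomogeneous w (map f F) e := by
  intro α hα
  refine hF fun h => hα ?_
  rw [coeff_map, h, map_zero]

lemma slAct_one {L : Type*} [Field L] (F : MvPolynomial (Fin (n + 1) × Fin (N + 1)) L) :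
    slAct 1 F = F := by
  rw [slAct_eq_rowSubst, Matrix.SpecialLinearGroup.coe_one, rowSubst_one]

lemma slAct_ne_zero {L : Type*} [Field L] (g : Matrix.SpecialLinearGroup (Fin (N + 1)) L)
    {F : MvPolynomial (Fin (n + 1) × Fin (N + 1)) L} (hF : F ≠ 0) : slAct g F ≠ 0 := by
  intro h
  refine hF ?_
  rw [← slAct_one F, ← inv_mul_cancel g, slAct_eq_rowSubst, Matrix.SpecialLinearGroup.coe_mul,
    ← rowSubst_rowSubst, ← slAct_eq_rowSubst g, h, map_zero]

lemma infOrbit_ne_zero (C : EffectiveCycle K n N) (v : InfinitePlace K)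
    (g : Matrix.SpecialLinearGroup (Fin (N + 1)) ℂ) : infOrbit C v g ≠ 0 :=
  slAct_ne_zero g <| (map_ne_zero_iff _ (map_injective _ v.embedding.injective)).2
    (chowForm_ne_zero C)

/-- The logarithmic size of the Chow form of `g C` at an infinite place: the part of the local
function that depends on `g`. -/
noncomputable def infLogNorm (C : EffectiveCycle K n N) (v : InfinitePlace K)
    (g : Matrix.SpecialLinearGroup (Fin (N + 1)) ℂ) : ℝ :=
  logChowNorm (degree C) (infOrbit C v g)

lemma infLocal_eq_add {C : EffectiveCycle K n N} (s : NonvanishingSection C)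
    (v : InfinitePlace K) (g : Matrix.SpecialLinearGroup (Fin (N + 1)) ℂ) :
    infLocal s v g = -Real.log (v s.value) / s.m + infLogNorm C v g := by
  have hm : (s.m : ℝ) ≠ 0 := Nat.cast_ne_zero.2 s.m_pos.ne'
  rw [infLocal, infLogNorm, InfinitePlace.norm_embedding_eq]
  field_simp
  ring

lemma NonvanishingSection.isWeightedHomogeneous_infOrbit {C : EffectiveCycle K n N}
    (s : NonvanishingSection C) (v : InfinitePlace K)
    (g : Matrix.SpecialLinearGroup (Fin (N + 1)) ℂ) :
    IsWeightedHomogeneous (multiWeight n N) (infOrbit C v g) fun _ => degree C :=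
  isWeightedHomogeneous_rowSubst _
    (isWeightedHomogeneous_map _ s.isWeightedHomogeneous_chowForm)

lemma infLogNorm_add {C₁ C₂ : EffectiveCycle K n N} (s₁ : NonvanishingSection C₁)
    (s₂ : NonvanishingSection C₂) (v : InfinitePlace K)
    (g : Matrix.SpecialLinearGroup (Fin (N + 1)) ℂ) :
    infLogNorm (C₁ + C₂) v g = infLogNorm C₁ v g + infLogNorm C₂ v g := by
  have h : infOrbit (C₁ + C₂) v g = infOrbit C₁ v g * infOrbit C₂ v g := by
    simp only [infOrbit, slAct_eq_rowSubst, chowForm_add, map_mul]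
  obtain ⟨-, -, hne₁, hint₁, -⟩ := (exists_log_sub_le_integral_logAbs n N (degree C₁)).choose_spec _
    (s₁.isWeightedHomogeneous_infOrbit v g) (infOrbit_ne_zero C₁ v g) |>.choose_spec
  obtain ⟨-, -, hne₂, hint₂, -⟩ := (exists_log_sub_le_integral_logAbs n N (degree C₂)).choose_spec _
    (s₂.isWeightedHomogeneous_infOrbit v g) (infOrbit_ne_zero C₂ v g) |>.choose_spec
  have hlog : logAbs (infOrbit C₁ v g * infOrbit C₂ v g)
      =ᵐ[Measure.pi fun _ : Fin (n + 1) => sphereMeasure N]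
      fun x => logAbs (infOrbit C₁ v g) x + logAbs (infOrbit C₂ v g) x := by
    filter_upwards [hne₁, hne₂] with x hx₁ hx₂
    rw [logAbs, map_mul, norm_mul]
    exact Real.log_mul (norm_ne_zero_iff.2 hx₁) (norm_ne_zero_iff.2 hx₂)
  rw [infLogNorm, infLogNorm, infLogNorm, h, logChowNorm, logChowNorm, logChowNorm,
    integral_congr_ae hlog, integral_add hint₁ hint₂, degree_add]
  push_cast
  ring

lemma map_chowForm_comp {L : Type*} [Field L] {φ : AlgebraicClosure K →+* L} {j : K →+* L}
    (hφ : φ.comp (algebraMap K (AlgebraicClosure K)) = j) (C : EffectiveCycle K n N) :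
    map φ (map (algebraMap K (AlgebraicClosure K)) (chowForm C)) = map j (chowForm C) := by
  rw [map_map, hφ]

lemma IsSemistable.bddBelow_inf {C : EffectiveCycle K n N} (h : IsSemistable C)
    (s : NonvanishingSection C) (v : InfinitePlace K) :
    BddBelow (Set.range (infLogNorm C v)) := by
  obtain ⟨m, hm, I, hI, hinv, hne⟩ := h
  obtain ⟨φ, hφ⟩ := exists_extension_algebraicClosure v.embedding
  have hG := isWeightedHomogeneous_map (algebraMap K (AlgebraicClosure K))
    s.isWeightedHomogeneous_chowForm
  set c := φ (evalCoeffs I (map (algebraMap K (AlgebraicClosure K)) (chowForm C)))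
  have hc : 0 < ‖c‖ := norm_pos_iff.2 ((map_ne_zero φ).2 hne)
  obtain ⟨B, hB⟩ := exists_norm_evalCoeffs_le (n := n) (N := N) (hI.map φ)
  obtain ⟨κ, hκ⟩ := exists_log_sub_le_integral_logAbs n N (degree C)
  refine ⟨1 / 2 * degree C * (n + 1) * ∑ j ∈ Finset.Icc 1 N, (1 / j : ℝ) +
    ((Real.log ‖c‖ - Real.log B) / m - κ), ?_⟩
  rintro _ ⟨g, rfl⟩
  obtain ⟨M, hM, hMle, -, -, hint⟩ := hκ _ (s.isWeightedHomogeneous_infOrbit v g)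
    (infOrbit_ne_zero C v g)
  have hle := hB _ (s.isWeightedHomogeneous_infOrbit v g) M hM.le hMle
  have hnorm : ‖evalCoeffs (map φ I) (infOrbit C v g)‖ = ‖c‖ := by
    have h := congrArg norm (evalCoeffs_rowSubst_pow hI hinv hG φ g)
    rwa [norm_pow, norm_pow, pow_left_inj₀ (norm_nonneg _) (norm_nonneg _) N.succ_ne_zero,
      map_chowForm_comp hφ] at h
  rw [hnorm] at hle
  have hB0 : 0 < B := pos_of_mul_pos_left (hc.trans_le hle) (pow_pos hM m).le
  have hlog := Real.log_le_log hc hle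
  rw [Real.log_mul hB0.ne' (pow_pos hM m).ne', Real.log_pow] at hlog
  refine add_le_add le_rfl (le_trans (sub_le_sub_right ?_ κ) hint)
  rw [div_le_iff₀ (Nat.cast_pos.2 hm)]
  linarith

variable [NumberField K]

lemma finOrbit_ne_zero (C : EffectiveCycle K n N) (v : HeightOneSpectrum (𝓞 K))
    (g : Matrix.SpecialLinearGroup (Fin (N + 1)) (FinAlgCl v)) : finOrbit C v g ≠ 0 :=
  slAct_ne_zero g <| (map_ne_zero_iff _ (map_injective _ (finEmb v).injective)).2
    (chowForm_ne_zero C)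

/-- The logarithm of the maximum of the coefficients of the Chow form of `g C` at a finite place:
the part of the local function that depends on `g`. -/
noncomputable def finLogMax (C : EffectiveCycle K n N) (v : HeightOneSpectrum (𝓞 K))
    (g : Matrix.SpecialLinearGroup (Fin (N + 1)) (FinAlgCl v)) : ℝ :=
  Real.log (coeffMax (finAbv v) (finOrbit C v g))

lemma finLocal_eq_add {C : EffectiveCycle K n N} (s : NonvanishingSection C)
    (v : HeightOneSpectrum (𝓞 K)) (g : Matrix.SpecialLinearGroup (Fin (N + 1)) (FinAlgCl v)) :
    finLocal s v g = -Real.log (FinitePlace.mk v s.value) / s.m + finLogMax C v g := by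
  have hval : FinitePlace.mk v s.value ≠ 0 := (FinitePlace.pos_iff.2 s.ne_zero).ne'
  have hpos := coeffMax_pos (finAbv v) (finOrbit_ne_zero C v g)
  have hm : (s.m : ℝ) ≠ 0 := Nat.cast_ne_zero.2 s.m_pos.ne'
  change -Real.log (finAbv v (finEmb v s.value) / coeffMax (finAbv v) (finOrbit C v g) ^ s.m) / s.m
    = _
  rw [finAbv_finEmb, Real.log_div hval (pow_pos hpos _).ne', Real.log_pow, finLogMax]
  field_simp
  ring

lemma finLogMax_add (C₁ C₂ : EffectiveCycle K n N) (v : HeightOneSpectrum (𝓞 K))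
    (g : Matrix.SpecialLinearGroup (Fin (N + 1)) (FinAlgCl v)) :
    finLogMax (C₁ + C₂) v g = finLogMax C₁ v g + finLogMax C₂ v g := by
  have h : finOrbit (C₁ + C₂) v g = finOrbit C₁ v g * finOrbit C₂ v g := by
    simp only [finOrbit, slAct_eq_rowSubst, chowForm_add, map_mul]
  rw [finLogMax, h, coeffMax_mul (isNonarchimedean_finAbv v),
    Real.log_mul (coeffMax_pos _ (finOrbit_ne_zero C₁ v g)).ne'
      (coeffMax_pos _ (finOrbit_ne_zero C₂ v g)).ne']
  rfl

/-- The orbit of the Chow form of a cycle stays away from zero: the functions `finLogMax` and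
`infLogNorm` are bounded below, and at almost all finite places `finLogMax` has minimum `0`,
attained at `g = 1`. Semistable cycles have this property, and it passes to sums. -/
structure OrbitBounds (C : EffectiveCycle K n N) : Prop where
  bddBelow_fin : ∀ v, BddBelow (Set.range (finLogMax C v))
  bddBelow_inf : ∀ v, BddBelow (Set.range (infLogNorm C v))
  finite_fin : {v | ¬((∀ g, 0 ≤ finLogMax C v g) ∧ finLogMax C v 1 = 0)}.Finite

lemma IsSemistable.bddBelow_fin {C : EffectiveCycle K n N} (h : IsSemistable C)
    (s : NonvanishingSection C) (v : HeightOneSpectrum (𝓞 K)) :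
    BddBelow (Set.range (finLogMax C v)) := by
  obtain ⟨m, hm, I, hI, hinv, hne⟩ := h
  obtain ⟨φ, hφ⟩ := exists_extension_algebraicClosure (finEmb v)
  have hG := isWeightedHomogeneous_map (algebraMap K (AlgebraicClosure K))
    s.isWeightedHomogeneous_chowForm
  obtain ⟨β, -, hβ⟩ := exists_coeffMax_eq ((finAbv v).comp φ.injective) I
  set B := finAbv v (φ (I.coeff β))
  have hβB : ∀ β', finAbv v (φ (I.coeff β')) ≤ B := hβ
  set c := finAbv v (φ (evalCoeffs I (map (algebraMap K (AlgebraicClosure K)) (chowForm C))))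
  have hc : 0 < c := (finAbv v).pos ((map_ne_zero φ).2 hne)
  refine ⟨(Real.log c - Real.log B) / m, ?_⟩
  rintro _ ⟨g, rfl⟩
  have hle : c ≤ B * coeffMax (finAbv v) (finOrbit C v g) ^ m := by
    have h := le_mul_coeffMax_slAct_pow (isNonarchimedean_finAbv v) hI hinv hG φ hβB g
    rwa [map_chowForm_comp hφ] at h
  have hpos := coeffMax_pos (finAbv v) (finOrbit_ne_zero C v g)
  have hB : 0 < B := pos_of_mul_pos_left (hc.trans_le hle) (pow_pos hpos m).le
  have hlog := Real.log_le_log hc hle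
  rw [Real.log_mul hB.ne' (pow_pos hpos m).ne', Real.log_pow] at hlog
  rw [div_le_iff₀ (Nat.cast_pos.2 hm)]
  rw [finLogMax]
  linarith

lemma IsSemistable.finite_fin {C : EffectiveCycle K n N} (h : IsSemistable C)
    (s : NonvanishingSection C) :
    {v | ¬((∀ g, 0 ≤ finLogMax C v g) ∧ finLogMax C v 1 = 0)}.Finite := by
  obtain ⟨m, hm, I, hI, hinv, hne⟩ := h
  have hG := isWeightedHomogeneous_map (algebraMap K (AlgebraicClosure K))
    s.isWeightedHomogeneous_chowForm
  set c := evalCoeffs I (map (algebraMap K (AlgebraicClosure K)) (chowForm C))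
  have hc : c ≠ 0 := hne
  refine (((Set.Finite.biUnion I.support.finite_toSet fun β _ =>
    finite_one_lt_finAbv (I.coeff β)).union (finite_one_lt_finAbv c⁻¹)).union
    (Set.Finite.biUnion (chowForm C).support.finite_toSet fun α hα =>
      finite_finAbv_finEmb_ne_one (mem_support_iff.1 hα))).subset fun v hv => ?_
  by_contra hgood
  simp only [Set.mem_union, Set.mem_iUnion, not_or, not_exists] at hgood
  obtain ⟨⟨hgI, hgc⟩, hgF⟩ := hgood
  obtain ⟨φ, hφ⟩ := exists_extension_algebraicClosure (finEmb v)
  have hI1 (β) : finAbv v (φ (I.coeff β)) ≤ 1 := by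
    by_cases hβ : β ∈ I.support
    · exact not_lt.1 fun h => hgI β hβ ⟨φ, hφ, h⟩
    · rw [notMem_support_iff.1 hβ, map_zero, map_zero]
      exact zero_le_one
  have hc1 : 1 ≤ finAbv v (φ c) := by
    have h : finAbv v (φ c⁻¹) ≤ 1 := not_lt.1 fun h => hgc ⟨φ, hφ, h⟩
    rw [map_inv₀, map_inv₀] at h
    exact (inv_le_one₀ ((finAbv v).pos ((map_ne_zero φ).2 hc))).1 h
  have hge (g) : 1 ≤ coeffMax (finAbv v) (finOrbit C v g) := by
    have hle := le_mul_coeffMax_slAct_pow (isNonarchimedean_finAbv v) hI hinv hG φ hI1 g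
    rw [map_chowForm_comp hφ, one_mul] at hle
    exact (one_le_pow_iff_of_nonneg (coeffMax_nonneg _ _) hm.ne').1 (hc1.trans hle)
  refine hv ⟨fun g => Real.log_nonneg (hge g), ?_⟩
  have h1 : coeffMax (finAbv v) (finOrbit C v 1) ≤ 1 := by
    refine ciSup_le fun α => ?_
    rw [finOrbit, slAct_one, coeff_map]
    by_cases hα : α ∈ (chowForm C).support
    · exact (not_not.1 (hgF α hα)).le
    · rw [notMem_support_iff.1 hα, map_zero, map_zero]
      exact zero_le_one
  rw [finLogMax, le_antisymm h1 (hge 1), Real.log_one]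

lemma IsSemistable.orbitBounds {C : EffectiveCycle K n N} (h : IsSemistable C)
    (s : NonvanishingSection C) : OrbitBounds C :=
  ⟨h.bddBelow_fin s, h.bddBelow_inf s, h.finite_fin s⟩

lemma OrbitBounds.add {C₁ C₂ : EffectiveCycle K n N} (h₁ : OrbitBounds C₁) (h₂ : OrbitBounds C₂)
    (s₁ : NonvanishingSection C₁) (s₂ : NonvanishingSection C₂) : OrbitBounds (C₁ + C₂) where
  bddBelow_fin v := by
    obtain ⟨b₁, hb₁⟩ := h₁.bddBelow_fin v
    obtain ⟨b₂, hb₂⟩ := h₂.bddBelow_fin v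
    refine ⟨b₁ + b₂, Set.forall_mem_range.2 fun g => ?_⟩
    rw [finLogMax_add]
    exact add_le_add (hb₁ ⟨g, rfl⟩) (hb₂ ⟨g, rfl⟩)
  bddBelow_inf v := by
    obtain ⟨b₁, hb₁⟩ := h₁.bddBelow_inf v
    obtain ⟨b₂, hb₂⟩ := h₂.bddBelow_inf v
    refine ⟨b₁ + b₂, Set.forall_mem_range.2 fun g => ?_⟩
    rw [infLogNorm_add s₁ s₂]
    exact add_le_add (hb₁ ⟨g, rfl⟩) (hb₂ ⟨g, rfl⟩)
  finite_fin := by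
    refine (h₁.finite_fin.union h₂.finite_fin).subset fun v hv => ?_
    by_contra hgood
    simp only [Set.mem_union, Set.mem_ofPred_eq, not_or, not_not] at hgood
    refine hv ⟨fun g => ?_, ?_⟩
    · rw [finLogMax_add]
      exact add_nonneg (hgood.1.1 g) (hgood.2.1 g)
    · rw [finLogMax_add, hgood.1.2, hgood.2.2, add_zero]

lemma OrbitBounds.finite_support {C : EffectiveCycle K n N} (h : OrbitBounds C) :
    (Function.support fun v => ⨅ g, finLogMax C v g).Finite := by
  refine h.finite_fin.subset fun v hv hgood => hv ?_
  exact le_antisymm ((ciInf_le (h.bddBelow_fin v) 1).trans hgood.2.le) (le_ciInf hgood.1)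

end Orbits

/-! ### The height as a sum of local minima -/

section Height

variable {K : Type*} [Field K] [NumberField K] {n N : ℕ}

/-- The logarithmic product formula. -/
lemma finsum_log_add_sum_log {x : K} (hx : x ≠ 0) :
    ∑ᶠ v : HeightOneSpectrum (𝓞 K), Real.log (FinitePlace.mk v x) +
      ∑ v : InfinitePlace K, (v.mult : ℝ) * Real.log (v x) = 0 := by
  have hfin := finite_finAbv_finEmb_ne_one (K := K) hx
  simp_rw [finAbv_finEmb] at hfin
  have hpos (v : HeightOneSpectrum (𝓞 K)) : 0 < FinitePlace.mk v x := FinitePlace.pos_iff.2 hx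
  have hpos' (v : InfinitePlace K) : 0 < v x := InfinitePlace.pos_iff.2 hx
  have h := congrArg Real.log (prod_abs_eq_one (K := K) hx)
  rw [← finprod_comp_equiv (FinitePlace.equivHeightOneSpectrum (K := K)).symm] at h
  simp only [FinitePlace.equivHeightOneSpectrum_symm_apply] at h
  have hmk (v : HeightOneSpectrum (𝓞 K)) : ‖FinitePlace.embedding v x‖ = FinitePlace.mk v x := rfl
  simp only [hmk] at h
  rw [finprod_eq_prod_of_mulSupport_subset (s := hfin.toFinset) _
      (fun v hv => by simpa using hv),
    Real.log_mul (Finset.prod_ne_zero_iff.2 fun v _ => (pow_pos (hpos' v) _).ne')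
      (Finset.prod_ne_zero_iff.2 fun v _ => (hpos v).ne'),
    Real.log_prod fun v _ => (pow_pos (hpos' v) _).ne', Real.log_prod fun v _ => (hpos v).ne',
    Real.log_one] at h
  rw [finsum_eq_sum_of_support_subset (s := hfin.toFinset) _ (fun v hv => by
    simp only [Set.Finite.coe_toFinset]
    exact fun h1 => hv (by dsimp only; rw [h1, Real.log_one])), add_comm]
  simpa only [Real.log_pow] using h

lemma ciInf_const_add {ι : Type*} [Nonempty ι] {f : ι → ℝ} (hf : BddBelow (Set.range f)) (c : ℝ) :
    ⨅ i, (c + f i) = c + ⨅ i, f i :=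
  ((OrderIso.addLeft c).map_ciInf hf).symm

lemma OrbitBounds.iInf_finLocal {C : EffectiveCycle K n N} (h : OrbitBounds C)
    (s : NonvanishingSection C) (v : HeightOneSpectrum (𝓞 K)) :
    ⨅ g, finLocal s v g = -Real.log (FinitePlace.mk v s.value) / s.m + ⨅ g, finLogMax C v g := by
  simp_rw [finLocal_eq_add]
  exact ciInf_const_add (h.bddBelow_fin v) _

lemma OrbitBounds.iInf_infLocal {C : EffectiveCycle K n N} (h : OrbitBounds C)
    (s : NonvanishingSection C) (v : InfinitePlace K) :
    ⨅ g, infLocal s v g = -Real.log (v s.value) / s.m + ⨅ g, infLogNorm C v g := by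
  simp_rw [infLocal_eq_add]
  exact ciInf_const_add (h.bddBelow_inf v) _

lemma finite_support_log {x : K} (hx : x ≠ 0) (m : ℝ) :
    (Function.support fun v : HeightOneSpectrum (𝓞 K) =>
      -Real.log (FinitePlace.mk v x) / m).Finite := by
  have hfin := finite_finAbv_finEmb_ne_one (K := K) hx
  simp_rw [finAbv_finEmb] at hfin
  refine hfin.subset fun v hv h1 => hv ?_
  dsimp only
  rw [h1, Real.log_one, neg_zero, zero_div]

lemma OrbitBounds.heightConverges {C : EffectiveCycle K n N} (h : OrbitBounds C)
    (s : NonvanishingSection C) : HeightConverges s where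
  bddBelow_fin v := by
    obtain ⟨b, hb⟩ := h.bddBelow_fin v
    refine ⟨-Real.log (FinitePlace.mk v s.value) / s.m + b, Set.forall_mem_range.2 fun g => ?_⟩
    rw [finLocal_eq_add]
    exact add_le_add le_rfl (hb ⟨g, rfl⟩)
  bddBelow_inf v := by
    obtain ⟨b, hb⟩ := h.bddBelow_inf v
    refine ⟨-Real.log (v s.value) / s.m + b, Set.forall_mem_range.2 fun g => ?_⟩
    rw [infLocal_eq_add]
    exact add_le_add le_rfl (hb ⟨g, rfl⟩)
  integrable v g := by
    obtain ⟨κ, hκ⟩ := exists_log_sub_le_integral_logAbs n N (degree C)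
    obtain ⟨M, -, -, -, hint, -⟩ := hκ _ (s.isWeightedHomogeneous_infOrbit v g)
      (infOrbit_ne_zero C v g)
    exact hint
  finite_support := by
    simp_rw [h.iInf_finLocal s]
    exact ((finite_support_log s.ne_zero s.m).union h.finite_support).subset
      (Function.support_add _ _)

/-- The height does not depend on the section: its value at the Chow point disappears by the product
formula. -/
lemma OrbitBounds.gitHeight_eq {C : EffectiveCycle K n N} (h : OrbitBounds C)
    (s : NonvanishingSection C) :
    gitHeight s = ((∑ᶠ v, ⨅ g, finLogMax C v g) +
      ∑ v : InfinitePlace K, (v.mult : ℝ) * ⨅ g, infLogNorm C v g) / Module.finrank ℚ K := by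
  have hs : s.value ≠ 0 := s.ne_zero
  have hprod := finsum_log_add_sum_log hs
  rw [gitHeight]
  congr 1
  simp_rw [h.iInf_finLocal s, h.iInf_infLocal s]
  rw [finsum_add_distrib (finite_support_log hs s.m) h.finite_support]
  simp_rw [mul_add, Finset.sum_add_distrib]
  have h1 : ∑ᶠ v : HeightOneSpectrum (𝓞 K), -Real.log (FinitePlace.mk v s.value) / s.m =
      -(∑ᶠ v : HeightOneSpectrum (𝓞 K), Real.log (FinitePlace.mk v s.value)) / s.m := by
    rw [neg_div, div_eq_mul_inv, finsum_mul', ← finsum_neg_distrib]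
    · exact finsum_congr fun v => by ring
    · have := finite_support_log hs (-1)
      simpa [Function.HasFiniteSupport] using this
  have h2 : ∑ v : InfinitePlace K, (v.mult : ℝ) * (-Real.log (v s.value) / s.m) =
      -(∑ v : InfinitePlace K, (v.mult : ℝ) * Real.log (v s.value)) / s.m := by
    rw [neg_div, Finset.sum_div, ← Finset.sum_neg_distrib]
    exact Finset.sum_congr rfl fun v _ => by ring
  rw [h1, h2]
  have h3 : ∑ᶠ v : HeightOneSpectrum (𝓞 K), Real.log (FinitePlace.mk v s.value) =
      -∑ v : InfinitePlace K, (v.mult : ℝ) * Real.log (v s.value) := by linarith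
  rw [h3]
  ring

lemma ciInf_add_ciInf_le {ι : Type*} [Nonempty ι] {f g : ι → ℝ} (hf : BddBelow (Set.range f))
    (hg : BddBelow (Set.range g)) : (⨅ i, f i) + ⨅ i, g i ≤ ⨅ i, (f i + g i) :=
  le_ciInf fun i => add_le_add (ciInf_le hf i) (ciInf_le hg i)

/-- If the infimum of a sum is the sum of the infima, a minimizer of the sum minimizes both
summands. -/
lemma minimizer_of_ciInf_add_eq {ι : Type*} [Nonempty ι] {f g : ι → ℝ}
    (hf : BddBelow (Set.range f)) (hg : BddBelow (Set.range g))
    (h : ⨅ i, (f i + g i) = (⨅ i, f i) + ⨅ i, g i) {i : ι} (hi : ∀ j, f i + g i ≤ f j + g j) :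
    (∀ j, f i ≤ f j) ∧ ∀ j, g i ≤ g j := by
  have h1 : f i + g i ≤ (⨅ i, f i) + ⨅ i, g i := h ▸ le_ciInf hi
  have hfi := ciInf_le hf i
  have hgi := ciInf_le hg i
  exact ⟨fun j => by linarith [ciInf_le hf j], fun j => by linarith [ciInf_le hg j]⟩

end Height

end GITHeight

open GITHeight
theorem mainTheorem4 {K : Type*} [Field K] [NumberField K] {n N : ℕ}
    (C₁ C₂ : EffectiveCycle K n N) (h₁ : IsSemistable C₁) (h₂ : IsSemistable C₂)
    (s₁ : NonvanishingSection C₁) (s₂ : NonvanishingSection C₂)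
    (s : NonvanishingSection (C₁ + C₂)) :
    (HeightConverges s₁ ∧ HeightConverges s₂ ∧ HeightConverges s) ∧
    gitHeight s₁ + gitHeight s₂ ≤ gitHeight s ∧
    (gitHeight s = gitHeight s₁ + gitHeight s₂ →
      (∀ v g, IsFinMinimizer s v g → IsFinMinimizer s₁ v g ∧ IsFinMinimizer s₂ v g) ∧
      (∀ v g, IsInfMinimizer s v g → IsInfMinimizer s₁ v g ∧ IsInfMinimizer s₂ v g)) := by
  have b₁ := h₁.orbitBounds s₁
  have b₂ := h₂.orbitBounds s₂
  have b := b₁.add b₂ s₁ s₂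
  -- the excess of the local minimum for the sum, at each place
  set δf : IsDedekindDomain.HeightOneSpectrum (NumberField.RingOfIntegers K) → ℝ := fun v =>
    (⨅ g, finLogMax (C₁ + C₂) v g) - ((⨅ g, finLogMax C₁ v g) + ⨅ g, finLogMax C₂ v g) with hδf
  set δi : NumberField.InfinitePlace K → ℝ := fun v =>
    (⨅ g, infLogNorm (C₁ + C₂) v g) - ((⨅ g, infLogNorm C₁ v g) + ⨅ g, infLogNorm C₂ v g) with hδi
  have hδf0 (v) : 0 ≤ δf v := by
    rw [hδf, sub_nonneg]
    simp_rw [finLogMax_add]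
    exact ciInf_add_ciInf_le (b₁.bddBelow_fin v) (b₂.bddBelow_fin v)
  have hδi0 (v) : 0 ≤ δi v := by
    rw [hδi, sub_nonneg]
    simp_rw [infLogNorm_add s₁ s₂]
    exact ciInf_add_ciInf_le (b₁.bddBelow_inf v) (b₂.bddBelow_inf v)
  have hsupp₁₂ : (Function.support fun v => (⨅ g, finLogMax C₁ v g) +
      ⨅ g, finLogMax C₂ v g).Finite :=
    (b₁.finite_support.union b₂.finite_support).subset (Function.support_add _ _)
  have hsupp : (Function.support δf).Finite :=
    (b.finite_support.union hsupp₁₂).subset (Function.support_sub _ _)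
  have hmult (v : NumberField.InfinitePlace K) : 0 ≤ (v.mult : ℝ) * δi v :=
    mul_nonneg (Nat.cast_nonneg _) (hδi0 v)
  have hrank : (0 : ℝ) < Module.finrank ℚ K := Nat.cast_pos.2 Module.finrank_pos
  have hsumf : ∑ᶠ v, δf v = (∑ᶠ v, ⨅ g, finLogMax (C₁ + C₂) v g) -
      ((∑ᶠ v, ⨅ g, finLogMax C₁ v g) + ∑ᶠ v, ⨅ g, finLogMax C₂ v g) := by
    rw [finsum_sub_distrib b.finite_support hsupp₁₂,
      finsum_add_distrib b₁.finite_support b₂.finite_support]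
  have hdiff : gitHeight s - (gitHeight s₁ + gitHeight s₂) =
      (∑ᶠ v, δf v + ∑ v, (v.mult : ℝ) * δi v) / Module.finrank ℚ K := by
    rw [b.gitHeight_eq, b₁.gitHeight_eq, b₂.gitHeight_eq, hsumf]
    simp_rw [hδi, mul_sub, mul_add, Finset.sum_sub_distrib, Finset.sum_add_distrib]
    ring
  have hf0 : 0 ≤ ∑ᶠ v, δf v := finsum_nonneg hδf0
  have hi0 : 0 ≤ ∑ v, (v.mult : ℝ) * δi v := Finset.sum_nonneg fun v _ => hmult v
  refine ⟨⟨b₁.heightConverges s₁, b₂.heightConverges s₂, b.heightConverges s⟩, ?_, fun heq => ?_⟩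
  · rw [← sub_nonneg, hdiff]
    positivity
  have hzero : ∑ᶠ v, δf v + ∑ v, (v.mult : ℝ) * δi v = 0 := by
    rw [heq, sub_self, eq_comm, div_eq_zero_iff] at hdiff
    exact hdiff.resolve_right hrank.ne'
  have hδfz (v) : δf v = 0 :=
    le_antisymm ((single_le_finsum v hsupp hδf0).trans (by linarith)) (hδf0 v)
  have hδiz (v) : δi v = 0 := by
    have h := (Finset.sum_eq_zero_iff_of_nonneg fun v _ => hmult v).1 (by linarith) v
      (Finset.mem_univ v)
    exact (mul_eq_zero.1 h).resolve_left (Nat.cast_ne_zero.2 NumberField.InfinitePlace.mult_ne_zero)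
  refine ⟨fun v g hg => ?_, fun v g hg => ?_⟩
  · have hinf := sub_eq_zero.1 (hδfz v)
    simp_rw [finLogMax_add] at hinf
    have hmin := minimizer_of_ciInf_add_eq (b₁.bddBelow_fin v) (b₂.bddBelow_fin v) hinf (i := g)
      fun g' => by
        have h := hg g'
        rwa [finLocal_eq_add, finLocal_eq_add, add_le_add_iff_left, finLogMax_add,
          finLogMax_add] at h
    refine ⟨fun g' => ?_, fun g' => ?_⟩ <;>
      rw [finLocal_eq_add, finLocal_eq_add, add_le_add_iff_left]
    exacts [hmin.1 g', hmin.2 g']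
  · have hinf := sub_eq_zero.1 (hδiz v)
    simp_rw [infLogNorm_add s₁ s₂] at hinf
    have hmin := minimizer_of_ciInf_add_eq (b₁.bddBelow_inf v) (b₂.bddBelow_inf v) hinf (i := g)
      fun g' => by
        have h := hg g'
        rwa [infLocal_eq_add, infLocal_eq_add, add_le_add_iff_left, infLogNorm_add s₁ s₂,
          infLogNorm_add s₁ s₂] at h
    refine ⟨fun g' => ?_, fun g' => ?_⟩ <;>
      rw [infLocal_eq_add, infLocal_eq_add, add_le_add_iff_left]
    exacts [hmin.1 g', hmin.2 g']
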